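/- Fix a universe, whose members are called small; categories are locally small. A \emph{Reedy category} is a small category $A$ with two wide subcategories $A^{\to}$ (direct part) and $A^{\gets}$ (inverse part) and a degree function from the objects of $A$ to an ordinal, such that nonidentity morphisms of $A^{\to}$ strictly raise degree, nonidentity morphisms of $A^{\gets}$ strictly lower degree, and every morphism of $A$ factors uniquely as a morphism of $A^{\gets}$ followed by a morphism of $A^{\to}$. A model category is \emph{combinatorial} if it is locally presentable and cofibrantly generated, i.e. there are small sets $I$ (generating cofibrations) and $J$ (generating trivial cofibrations) of morphisms, each permitting the small object argument, such that the trivial fibrations are exactly the morphisms with the right lifting property with respect to $I$, and the fibrations are exactly those with the right lifting property with respect to $J$. Let $A$ be a small Reedy category and let $\mathbf{M}$ be a complete and cocomplete model category. Write $\mathbf{M}(A)$ for the category of functors $A^{\mathrm{op}}\to\mathbf{M}$. For $Y\in\mathbf{M}(A)$ and $\alpha\in A$, let $L_\alpha Y=\operatorname{colim} Y_\beta$, over the category of nonidentity morphisms $\alpha\to\beta$ of $A^{\gets}$, and $M^\alpha Y=\lim Y_\beta$, over the category of nonidentity morphisms $\beta\to\alpha$ of $A^{\to}$, be its latching and matching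 objects. For a presheaf of sets $K$ on $A$ and $X\in\mathbf{M}$ let $(K\boxdot X)_\beta=\coprod_{K_\beta}X$. Let $y(\alpha)$ be the presheaf represented by $\alpha$, and let $\partial y(\alpha)=\operatorname{colim} y(\beta)$, over the category of nonidentity morphisms $\beta\to\alpha$ of $A^{\to}$, with its canonical morphism to $y(\alpha)$. For a set $K$ of morphisms of $\mathbf{M}$ let $$\Lambda\Box K=\{(y(\alpha)\boxdot X)\sqcup^{\partial y(\alpha)\boxdot X}(\partial y(\alpha)\boxdot Y)\to y(\alpha)\boxdot Y \mid \alpha\in A,\ [X\to Y]\in K\}.$$ If $\mathbf{M}$ is combinatorial, then $\mathbf{M}(A)$ carries the Reedy model structure, in which a morphism $X\to Y$ is a weak equivalence if and only if every $X_\alpha\to Y_\alpha$ is one, a cofibration if and only if every $X_\alpha\sqcup^{L_\alpha X}L_\alpha Y\to Y_\alpha$ is one, and a fibration if and only if every $X_\alpha\to M^\alpha X\times_{M^\alpha Y}Y_\alpha$ is one. With this model structure $\mathbf{M}(A)$ is combinatorial. Moreover, whenever $I$ and $J$ are small sets of generating cofibrations and generating trivial cofibrations of $\mathbf{M}$, $\Lambda\Box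 I$ and $\Lambda\Box J$ are small sets of generating cofibrations and generating trivial cofibrations of $\mathbf{M}(A)$. -/

import Mathlib

open CategoryTheory Limits HomotopicalAlgebra

universe w v u t

namespace ReedyDiagrams

section LatchingMatching

variable {B : Type w} [SmallCategory B] {C : Type u} [Category.{v} C]

/-- The nonidentity morphisms of the class `W`. -/
def nonIdentities (W : MorphismProperty B) : MorphismProperty B :=
  fun _ _ f => W f ∧ ¬ MorphismProperty.identities B f

variable (W : MorphismProperty B) [W.IsMultiplicative]

/-- For a wide subcategory `W` of `B`, the category `∂(W/b)`: the full subcategory of the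
slice `W/b` on the nonidentity morphisms `c ⟶ b` of `W` (a morphism of `∂(W/b)` is a
morphism of `W` over `b`). For `W` the direct part this is the latching category. -/
abbrev LatchingCategory (b : B) : Type w := (nonIdentities W).Over W b

/-- For a wide subcategory `W` of `B`, the category `∂(b/W)`: the full subcategory of the
coslice `b/W` on the nonidentity morphisms `b ⟶ c` of `W`. For `W` the inverse part this is
the matching category. -/
abbrev MatchingCategory (b : B) : Type w := (nonIdentities W).Under W b

/-- The forgetful functor `∂(W/b) ⥤ B`. -/
abbrev latchingForget (b : B) : LatchingCategory W b ⥤ B :=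
  MorphismProperty.Over.forget _ _ b ⋙ Over.forget b

/-- The forgetful functor `∂(b/W) ⥤ B`. -/
abbrev matchingForget (b : B) : MatchingCategory W b ⥤ B :=
  MorphismProperty.Under.forget _ _ b ⋙ Under.forget b

section Latching

variable [HasColimitsOfSize.{w, w} C]

/-- The latching object `L_b X`. -/
noncomputable def latchingObj (X : B ⥤ C) (b : B) : C :=
  colimit (latchingForget W b ⋙ X)

/-- The cocone on `∂(W/b) ⥤ B ⥤ C` with point `X_b` and components `X(f)`. -/
def latchingCocone (X : B ⥤ C) (b : B) : Cocone (latchingForget W b ⋙ X) where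
  pt := X.obj b
  ι :=
    { app := fun f => X.map f.hom
      naturality := fun f g φ => by
        change X.map φ.left ≫ X.map g.hom = X.map f.hom ≫ 𝟙 _
        rw [← X.map_comp, MorphismProperty.Over.w φ, Category.comp_id] }

/-- The canonical morphism `L_b X ⟶ X_b`. -/
noncomputable def latchingMap (X : B ⥤ C) (b : B) : latchingObj W X b ⟶ X.obj b :=
  colimit.desc (latchingForget W b ⋙ X) (latchingCocone W X b)

/-- The morphism `L_b X ⟶ L_b Y` induced by `φ : X ⟶ Y`. -/
noncomputable def latchingObjMap {X Y : B ⥤ C} (φ : X ⟶ Y) (b : B) :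
    latchingObj W X b ⟶ latchingObj W Y b :=
  colimMap (Functor.whiskerLeft (latchingForget W b) φ)

lemma latchingMap_naturality {X Y : B ⥤ C} (φ : X ⟶ Y) (b : B) :
    latchingMap W X b ≫ φ.app b = latchingObjMap W φ b ≫ latchingMap W Y b := by
  apply colimit.hom_ext
  intro j
  dsimp only [latchingMap, latchingObjMap]
  erw [colimit.ι_desc_assoc, ι_colimMap_assoc, colimit.ι_desc]
  exact φ.naturality j.hom

/-- The relative latching morphism `X_b ⊔^{L_b X} L_b Y ⟶ Y_b` of `φ : X ⟶ Y`. -/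
noncomputable def relativeLatchingMap {X Y : B ⥤ C} (φ : X ⟶ Y) (b : B)
    [HasPushouts C] :
    pushout (latchingMap W X b) (latchingObjMap W φ b) ⟶ Y.obj b :=
  pushout.desc (φ.app b) (latchingMap W Y b) (latchingMap_naturality W φ b)

end Latching

section Matching

variable [HasLimitsOfSize.{w, w} C]

/-- The matching object `M^b X`. -/
noncomputable def matchingObj (X : B ⥤ C) (b : B) : C :=
  limit (matchingForget W b ⋙ X)

/-- The cone on `∂(b/W) ⥤ B ⥤ C` with point `X_b` and components `X(f)`. -/
def matchingCone (X : B ⥤ C) (b : B) : Cone (matchingForget W b ⋙ X) where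
  pt := X.obj b
  π :=
    { app := fun f => X.map f.hom
      naturality := fun f g φ => by
        change 𝟙 _ ≫ X.map g.hom = X.map f.hom ≫ X.map φ.right
        rw [← X.map_comp, MorphismProperty.Under.w φ, Category.id_comp] }

/-- The canonical morphism `X_b ⟶ M^b X`. -/
noncomputable def matchingMap (X : B ⥤ C) (b : B) : X.obj b ⟶ matchingObj W X b :=
  limit.lift (matchingForget W b ⋙ X) (matchingCone W X b)

/-- The morphism `M^b X ⟶ M^b Y` induced by `φ : X ⟶ Y`. -/
noncomputable def matchingObjMap {X Y : B ⥤ C} (φ : X ⟶ Y) (b : B) :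
    matchingObj W X b ⟶ matchingObj W Y b :=
  limMap (Functor.whiskerLeft (matchingForget W b) φ)

lemma matchingMap_naturality {X Y : B ⥤ C} (φ : X ⟶ Y) (b : B) :
    matchingMap W X b ≫ matchingObjMap W φ b = φ.app b ≫ matchingMap W Y b := by
  apply limit.hom_ext
  intro j
  dsimp only [matchingMap, matchingObjMap]
  erw [Category.assoc, limMap_π, limit.lift_π_assoc, Category.assoc, limit.lift_π]
  exact φ.naturality j.hom

/-- The relative matching morphism `X_b ⟶ M^b X ×_{M^b Y} Y_b` of `φ : X ⟶ Y`. -/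
noncomputable def relativeMatchingMap {X Y : B ⥤ C} (φ : X ⟶ Y) (b : B)
    [HasPullbacks C] :
    X.obj b ⟶ pullback (matchingObjMap W φ b) (matchingMap W Y b) :=
  pullback.lift (matchingMap W X b) (φ.app b) (matchingMap_naturality W φ b)

end Matching

end LatchingMatching

section ModelStructures

/-- For a Reedy category `B` with inverse part `W₁` (degree-lowering morphisms) and direct
part `W₂` (degree-raising morphisms), the assertion that a model structure on `B ⥤ M` is the
Reedy model structure: weak equivalences are objectwise, cofibrations are the morphisms all of
whose relative latching morphisms are cofibrations, and fibrations are the morphisms all of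
whose relative matching morphisms are fibrations. -/
structure IsReedyModelStructure {B : Type w} [SmallCategory B]
    (W₁ W₂ : MorphismProperty B) [W₁.IsMultiplicative] [W₂.IsMultiplicative]
    {M : Type u} [Category.{v} M] [HasLimitsOfSize.{w, w} M] [HasColimitsOfSize.{w, w} M]
    [ModelCategory M] (S : ModelCategory (B ⥤ M)) : Prop where
  weakEquivalences_iff : ∀ {X Y : B ⥤ M} (φ : X ⟶ Y),
    S.categoryWithWeakEquivalences.weakEquivalences φ ↔
      ∀ b : B, weakEquivalences M (φ.app b)
  cofibrations_iff : ∀ {X Y : B ⥤ M} (φ : X ⟶ Y),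
    S.categoryWithCofibrations.cofibrations φ ↔
      ∀ b : B, cofibrations M (relativeLatchingMap W₂ φ b)
  fibrations_iff : ∀ {X Y : B ⥤ M} (φ : X ⟶ Y),
    S.categoryWithFibrations.fibrations φ ↔
      ∀ b : B, fibrations M (relativeMatchingMap W₁ φ b)

/-- `I` and `J` are (`w`-small) sets of generating cofibrations and of generating trivial
cofibrations of the model category `C`: both are `w`-small and permit the small object argument
(`HasSmallObjectArgument` includes the smallness of the set and the smallness of the domains
relative to cell complexes), the trivial fibrations are the morphisms with the right lifting
property with respect to `I`, and the fibrations are the morphisms with the right lifting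
property with respect to `J`. -/
structure AreGenerating {C : Type u} [Category.{v} C] [ModelCategory C]
    (I J : MorphismProperty C) : Prop where
  isSmall_I : MorphismProperty.IsSmall.{w} I
  isSmall_J : MorphismProperty.IsSmall.{w} J
  hasSmallObjectArgument_I : MorphismProperty.HasSmallObjectArgument.{w} I
  hasSmallObjectArgument_J : MorphismProperty.HasSmallObjectArgument.{w} J
  trivialFibrations_eq : trivialFibrations C = I.rlp
  fibrations_eq : fibrations C = J.rlp

/-- A model category is (`w`-)combinatorial if it is locally presentable and
cofibrantly generated. -/
structure IsCombinatorial (C : Type u) [Category.{v} C] [ModelCategory C] : Prop where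
  isLocallyPresentable : IsLocallyPresentable.{w} C
  exists_generating : ∃ I J : MorphismProperty C, AreGenerating.{w} I J

end ModelStructures

section BoundaryPushoutProducts

variable (A : Type w) [SmallCategory A] (M : Type u) [Category.{w} M] [HasColimits M]

/-- The bifunctor `(K, X) ↦ K ⊡ X` from presheaves of sets on `A` and objects of `M` to
`M`-valued presheaves on `A`, where `(K ⊡ X)_a` is the copower `K_a · X = ∐_{K_a} X`. -/
noncomputable def boxdot : (Aᵒᵖ ⥤ Type w) ⥤ M ⥤ (Aᵒᵖ ⥤ M) :=
  ((sigmaConst.{w} : M ⥤ Type w ⥤ M) ⋙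
    (Functor.whiskeringRight Aᵒᵖ (Type w) M)).flip

variable {A M}
variable (W₂ : MorphismProperty A) [W₂.IsMultiplicative]

/-- The boundary `∂y(a)` of the representable presheaf `y(a)`: the colimit of `y(c)` over the
nonidentity morphisms `c ⟶ a` of the direct part `W₂`. -/
noncomputable def boundary (a : A) : Aᵒᵖ ⥤ Type w :=
  latchingObj W₂ (yoneda : A ⥤ Aᵒᵖ ⥤ Type w) a

/-- The canonical morphism `∂y(a) ⟶ y(a)`. -/
noncomputable def boundaryMap (a : A) : boundary W₂ a ⟶ yoneda.obj a :=
  latchingMap W₂ (yoneda : A ⥤ Aᵒᵖ ⥤ Type w) a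

/-- The pushout-product
`(y(a) ⊡ X) ⊔^{∂y(a) ⊡ X} (∂y(a) ⊡ Y) ⟶ y(a) ⊡ Y` of `∂y(a) ⟶ y(a)` and `f : X ⟶ Y`. -/
noncomputable def boundaryPushoutProduct (a : A) {X Y : M} (f : X ⟶ Y) :
    pushout (((boxdot A M).map (boundaryMap W₂ a)).app X)
      (((boxdot A M).obj (boundary W₂ a)).map f) ⟶
        ((boxdot A M).obj (yoneda.obj a)).obj Y :=
  pushout.desc (((boxdot A M).obj (yoneda.obj a)).map f)
    (((boxdot A M).map (boundaryMap W₂ a)).app Y)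
    (((boxdot A M).map (boundaryMap W₂ a)).naturality f).symm

/-- The set `Λ □ K` of all pushout-products of the boundary inclusions `∂y(a) ⟶ y(a)`
with the elements of `K`. -/
inductive boundaryPushoutProducts (K : MorphismProperty M) : MorphismProperty (Aᵒᵖ ⥤ M)
  | mk (a : A) {X Y : M} (f : X ⟶ Y) (hf : K f) :
      boundaryPushoutProducts K (boundaryPushoutProduct W₂ a f)

end BoundaryPushoutProducts

end ReedyDiagrams

namespace ReedyDiagrams

section DependentChoice

/-- Dependent choice along a well-founded transitive relation. -/
lemma exists_forall_of_wellFounded {α : Type*} {s : α → α → Prop} (hs : WellFounded s)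
    {T : α → Type*} (Good : ∀ a, (∀ b, s b a → T b) → T a → Prop)
    (trans : ∀ {a b c}, s a b → s b c → s a c)
    (step : ∀ a (l : ∀ b, s b a → T b),
      (∀ b hb, Good b (fun c hc => l c (trans hc hb)) (l b hb)) → ∃ x, Good a l x) :
    ∃ l : ∀ a, T a, ∀ a, Good a (fun b _ => l b) (l a) := by
  classical
  let P (a : α) (rec : ∀ b, s b a → Option (T b)) (l : ∀ b, s b a → T b) : Prop :=
    (∀ b hb, rec b hb = some (l b hb)) ∧
      ∀ b hb, Good b (fun c hc => l c (trans hc hb)) (l b hb)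
  let F (a : α) (rec : ∀ b, s b a → Option (T b)) : Option (T a) :=
    if h : ∃ l, P a rec l then some (step a h.choose h.choose_spec.2).choose else none
  let g : ∀ a, Option (T a) := hs.fix F
  have hg (a : α) : g a = F a (fun b _ => g b) := hs.fix_eq F a
  have key : ∀ a, ∃ (l : ∀ b, s b a → T b) (x : T a),
      (∀ b hb, g b = some (l b hb)) ∧ g a = some x ∧ Good a l x := by
    intro a
    induction a using hs.induction with
    | _ a ih =>
      have h : ∃ l, P a (fun b _ => g b) l := by
        choose l' x h₁ h₂ h₃ using ih
        refine ⟨x, h₂, fun b hb => ?_⟩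
        convert h₃ b hb using 1
        funext c hc
        have := h₁ b hb c hc
        rw [h₂ c (trans hc hb)] at this
        exact Option.some_injective _ this
      refine ⟨h.choose, _, h.choose_spec.1, ?_, (step a h.choose h.choose_spec.2).choose_spec⟩
      rw [hg]
      exact dif_pos h
  choose l' x h₁ h₂ h₃ using key
  refine ⟨x, fun a => ?_⟩
  convert h₃ a using 1
  funext b hb
  have := h₁ a b hb
  rw [h₂ b] at this
  exact Option.some_injective _ this

end DependentChoice

section Leibniz

variable {C : Type*} [Category* C] {D : Type*} [Category* D]

lemma hasLiftingProperty_pushoutDesc_iff {S A B T P Q : C} {a : S ⟶ A} {b : S ⟶ B}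
    [HasPushout a b] {i : A ⟶ T} {j : B ⟶ T} (h : a ≫ i = b ≫ j) (p : P ⟶ Q) :
    HasLiftingProperty (pushout.desc i j h) p ↔
      ∀ (x : A ⟶ P) (y : B ⟶ P) (q : T ⟶ Q), a ≫ x = b ≫ y → x ≫ p = i ≫ q →
        y ≫ p = j ≫ q → ∃ l : T ⟶ P, i ≫ l = x ∧ j ≫ l = y ∧ l ≫ p = q := by
  constructor
  · intro _ x y q h₁ h₂ h₃
    have sq : CommSq (pushout.desc x y h₁) (pushout.desc i j h) p q := ⟨by
      apply pushout.hom_ext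
      · rw [pushout.inl_desc_assoc, pushout.inl_desc_assoc, h₂]
      · rw [pushout.inr_desc_assoc, pushout.inr_desc_assoc, h₃]⟩
    refine ⟨sq.lift, ?_, ?_, sq.fac_right⟩
    · have := pushout.inl a b ≫= sq.fac_left
      rwa [pushout.inl_desc_assoc, pushout.inl_desc] at this
    · have := pushout.inr a b ≫= sq.fac_left
      rwa [pushout.inr_desc_assoc, pushout.inr_desc] at this
  · intro H
    refine ⟨fun {x q} sq => ?_⟩
    obtain ⟨l, h₁, h₂, h₃⟩ := H (pushout.inl a b ≫ x) (pushout.inr a b ≫ x) q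
      (by rw [pushout.condition_assoc])
      (by rw [Category.assoc, sq.w, pushout.inl_desc_assoc])
      (by rw [Category.assoc, sq.w, pushout.inr_desc_assoc])
    refine ⟨⟨l, ?_, h₃⟩⟩
    apply pushout.hom_ext
    · rw [pushout.inl_desc_assoc, h₁]
    · rw [pushout.inr_desc_assoc, h₂]

lemma hasLiftingProperty_pullbackLift_iff {S A B T X Y : C} {a : A ⟶ S} {b : B ⟶ S}
    [HasPullback a b] {i : T ⟶ A} {j : T ⟶ B} (h : i ≫ a = j ≫ b) (f : X ⟶ Y) :
    HasLiftingProperty f (pullback.lift i j h) ↔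
      ∀ (x : X ⟶ T) (y : Y ⟶ A) (q : Y ⟶ B), y ≫ a = q ≫ b → x ≫ i = f ≫ y →
        x ≫ j = f ≫ q → ∃ l : Y ⟶ T, f ≫ l = x ∧ l ≫ i = y ∧ l ≫ j = q := by
  constructor
  · intro _ x y q h₁ h₂ h₃
    have sq : CommSq x f (pullback.lift i j h) (pullback.lift y q h₁) := ⟨by
      apply pullback.hom_ext
      · rw [Category.assoc, Category.assoc, pullback.lift_fst, pullback.lift_fst, h₂]
      · rw [Category.assoc, Category.assoc, pullback.lift_snd, pullback.lift_snd, h₃]⟩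
    refine ⟨sq.lift, sq.fac_left, ?_, ?_⟩
    · have := sq.fac_right =≫ pullback.fst a b
      rwa [Category.assoc, pullback.lift_fst, pullback.lift_fst] at this
    · have := sq.fac_right =≫ pullback.snd a b
      rwa [Category.assoc, pullback.lift_snd, pullback.lift_snd] at this
  · intro H
    refine ⟨fun {x q} sq => ?_⟩
    obtain ⟨l, h₁, h₂, h₃⟩ := H x (q ≫ pullback.fst a b) (q ≫ pullback.snd a b)
      (by rw [Category.assoc, pullback.condition, Category.assoc])
      (by rw [← sq.w_assoc, pullback.lift_fst])
      (by rw [← sq.w_assoc, pullback.lift_snd])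
    refine ⟨⟨l, h₁, ?_⟩⟩
    apply pullback.hom_ext
    · rw [Category.assoc, pullback.lift_fst, h₂]
    · rw [Category.assoc, pullback.lift_snd, h₃]

/-- If `α : G ⟶ H` and `α' : H' ⟶ G'` are conjugate under adjunctions `G ⊣ G'` and `H ⊣ H'`,
the Leibniz construction of `α` at `f` lifts against `p` if and only if `f` lifts against the
Leibniz construction of `α'` at `p`. -/
theorem hasLiftingProperty_leibniz_iff {G H : C ⥤ D} {G' H' : D ⥤ C} (adjG : G ⊣ G')
    (adjH : H ⊣ H') (α : G ⟶ H) (α' : H' ⟶ G')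
    (compat : ∀ (X : C) (P : D) (φ : H.obj X ⟶ P),
      adjG.homEquiv X P (α.app X ≫ φ) = adjH.homEquiv X P φ ≫ α'.app P)
    {X Y : C} (f : X ⟶ Y) {P Q : D} (p : P ⟶ Q)
    [HasPushout (α.app X) (G.map f)] [HasPullback (G'.map p) (α'.app Q)] :
    HasLiftingProperty (pushout.desc (f := α.app X) (g := G.map f) (H.map f) (α.app Y)
        (α.naturality f).symm) p ↔
      HasLiftingProperty f (pullback.lift (f := G'.map p) (g := α'.app Q) (α'.app P) (H'.map p)
        (α'.naturality p).symm) := by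
  rw [hasLiftingProperty_pushoutDesc_iff, hasLiftingProperty_pullbackLift_iff]
  constructor
  · intro h x y q h₁ h₂ h₃
    obtain ⟨x, rfl⟩ := (adjH.homEquiv _ _).surjective x
    obtain ⟨y, rfl⟩ := (adjG.homEquiv _ _).surjective y
    obtain ⟨q, rfl⟩ := (adjH.homEquiv _ _).surjective q
    rw [← adjG.homEquiv_naturality_right, ← compat, EmbeddingLike.apply_eq_iff_eq] at h₁
    rw [← adjG.homEquiv_naturality_left, ← compat, EmbeddingLike.apply_eq_iff_eq] at h₂
    rw [← adjH.homEquiv_naturality_left, ← adjH.homEquiv_naturality_right,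
      EmbeddingLike.apply_eq_iff_eq] at h₃
    obtain ⟨l, rfl, rfl, rfl⟩ := h x y q h₂ h₃ h₁
    exact ⟨adjH.homEquiv _ _ l, (adjH.homEquiv_naturality_left _ _).symm, (compat _ _ _).symm,
      (adjH.homEquiv_naturality_right _ _).symm⟩
  · intro h x y q h₁ h₂ h₃
    obtain ⟨l, hl₁, hl₂, hl₃⟩ := h (adjH.homEquiv _ _ x) (adjG.homEquiv _ _ y)
      (adjH.homEquiv _ _ q)
      (by rw [← adjG.homEquiv_naturality_right, ← compat, h₃])
      (by rw [← adjG.homEquiv_naturality_left, ← compat, h₁])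
      (by rw [← adjH.homEquiv_naturality_left, ← adjH.homEquiv_naturality_right, h₂])
    obtain ⟨l, rfl⟩ := (adjH.homEquiv _ _).surjective l
    rw [← adjH.homEquiv_naturality_left, EmbeddingLike.apply_eq_iff_eq] at hl₁
    rw [← compat, EmbeddingLike.apply_eq_iff_eq] at hl₂
    rw [← adjH.homEquiv_naturality_right, EmbeddingLike.apply_eq_iff_eq] at hl₃
    exact ⟨l, hl₁, hl₂, hl₃⟩

end Leibniz

end ReedyDiagrams

namespace ReedyDiagrams

section ElementsOfLatchingAndMatching

variable {B : Type w} [SmallCategory B] {C : Type u} [Category.{v} C]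
variable (W : MorphismProperty B) [W.IsMultiplicative]

section Latching

variable [HasColimitsOfSize.{w, w} C]

/-- The morphism `X_c ⟶ L_b X` associated with a nonidentity morphism `c ⟶ b` of `W`. -/
noncomputable def latchingι (X : B ⥤ C) {b c : B} (m : c ⟶ b) (hm : nonIdentities W m) :
    X.obj c ⟶ latchingObj W X b :=
  colimit.ι (latchingForget W b ⋙ X) (MorphismProperty.Over.mk W m hm)

lemma latchingι_latchingMap (X : B ⥤ C) {b c : B} (m : c ⟶ b) (hm : nonIdentities W m) :
    latchingι W X m hm ≫ latchingMap W X b = X.map m :=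
  colimit.ι_desc _ _

lemma latchingι_latchingObjMap {X Y : B ⥤ C} (φ : X ⟶ Y) {b c : B} (m : c ⟶ b)
    (hm : nonIdentities W m) :
    latchingι W X m hm ≫ latchingObjMap W φ b = φ.app c ≫ latchingι W Y m hm :=
  ι_colimMap _ _

lemma map_latchingι (X : B ⥤ C) {b c d : B} (g : c ⟶ d) (hg : W g) (m : d ⟶ b)
    (hm : nonIdentities W m) (hm' : nonIdentities W (g ≫ m)) :
    X.map g ≫ latchingι W X m hm = latchingι W X (g ≫ m) hm' :=
  colimit.w (latchingForget W b ⋙ X) 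
    (j := MorphismProperty.Over.mk W m hm) (j' := MorphismProperty.Over.mk W (g ≫ m) hm')
    (MorphismProperty.Over.homMk g rfl hg)

variable {W} in
lemma latchingObj_hom_ext {X : B ⥤ C} {b : B} {P : C} {f g : latchingObj W X b ⟶ P}
    (h : ∀ {c} (m : c ⟶ b) hm, latchingι W X m hm ≫ f = latchingι W X m hm ≫ g) : f = g :=
  colimit.hom_ext fun j => h j.hom j.prop

/-- Compatible families define morphisms from latching objects. -/
lemma exists_latchingι_comp_eq (X : B ⥤ C) {b : B} {P : C}
    (x : ∀ {c : B} (m : c ⟶ b), nonIdentities W m → (X.obj c ⟶ P))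
    (hx : ∀ {c d : B} (g : c ⟶ d), nonIdentities W g → ∀ (m : d ⟶ b) (hm : nonIdentities W m)
      (hm' : nonIdentities W (g ≫ m)), X.map g ≫ x m hm = x (g ≫ m) hm') :
    ∃ y : latchingObj W X b ⟶ P, ∀ {c : B} (m : c ⟶ b) (hm : nonIdentities W m),
      latchingι W X m hm ≫ y = x m hm := by
  have hx' {c d : B} (g : c ⟶ d) (hg : W g) (m : d ⟶ b) (hm : nonIdentities W m)
      (m' : c ⟶ b) (hm' : nonIdentities W m') (e : g ≫ m = m') :
      X.map g ≫ x m hm = x m' hm' := by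
    by_cases hid : MorphismProperty.identities B g
    · cases hid
      obtain rfl : m = m' := by simpa using e
      simp
    · subst e
      exact hx g ⟨hg, hid⟩ m hm hm'
  refine ⟨colimit.desc (latchingForget W b ⋙ X) ⟨P, { app := fun j => x j.hom j.prop
                                                      naturality := fun i j g => ?_ }⟩,
    fun m hm => colimit.ι_desc _ (MorphismProperty.Over.mk W m hm)⟩
  exact (hx' g.left g.prop_hom_left j.hom j.prop i.hom i.prop
    (MorphismProperty.Over.w g)).trans (Category.comp_id _).symm

end Latching

section Matching

variable [HasLimitsOfSize.{w, w} C]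

/-- The morphism `M^b X ⟶ X_c` associated with a nonidentity morphism `b ⟶ c` of `W`. -/
noncomputable def matchingπ (X : B ⥤ C) {b c : B} (m : b ⟶ c) (hm : nonIdentities W m) :
    matchingObj W X b ⟶ X.obj c :=
  limit.π (matchingForget W b ⋙ X) (MorphismProperty.Under.mk W m hm)

lemma matchingMap_matchingπ (X : B ⥤ C) {b c : B} (m : b ⟶ c) (hm : nonIdentities W m) :
    matchingMap W X b ≫ matchingπ W X m hm = X.map m :=
  limit.lift_π _ _

lemma matchingObjMap_matchingπ {X Y : B ⥤ C} (φ : X ⟶ Y) {b c : B} (m : b ⟶ c)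
    (hm : nonIdentities W m) :
    matchingObjMap W φ b ≫ matchingπ W Y m hm = matchingπ W X m hm ≫ φ.app c :=
  limMap_π _ _

lemma matchingπ_map (X : B ⥤ C) {b c d : B} (m : b ⟶ c) (hm : nonIdentities W m) (g : c ⟶ d)
    (hg : W g) (hm' : nonIdentities W (m ≫ g)) :
    matchingπ W X m hm ≫ X.map g = matchingπ W X (m ≫ g) hm' :=
  limit.w (matchingForget W b ⋙ X) (j := MorphismProperty.Under.mk W m hm)
    (j' := MorphismProperty.Under.mk W (m ≫ g) hm') (MorphismProperty.Under.homMk g rfl hg)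

variable {W} in
lemma matchingObj_hom_ext {X : B ⥤ C} {b : B} {P : C} {f g : P ⟶ matchingObj W X b}
    (h : ∀ {c} (m : b ⟶ c) hm, f ≫ matchingπ W X m hm = g ≫ matchingπ W X m hm) : f = g :=
  limit.hom_ext fun j => h j.hom j.prop

/-- Compatible families define morphisms to matching objects. -/
lemma exists_comp_matchingπ_eq (X : B ⥤ C) {b : B} {P : C}
    (x : ∀ {c : B} (m : b ⟶ c), nonIdentities W m → (P ⟶ X.obj c))
    (hx : ∀ {c d : B} (m : b ⟶ c) (hm : nonIdentities W m) (g : c ⟶ d), nonIdentities W g →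
      ∀ (hm' : nonIdentities W (m ≫ g)), x m hm ≫ X.map g = x (m ≫ g) hm') :
    ∃ y : P ⟶ matchingObj W X b, ∀ {c : B} (m : b ⟶ c) (hm : nonIdentities W m),
      y ≫ matchingπ W X m hm = x m hm := by
  have hx' {c d : B} (g : c ⟶ d) (hg : W g) (m : b ⟶ c) (hm : nonIdentities W m)
      (m' : b ⟶ d) (hm' : nonIdentities W m') (e : m ≫ g = m') :
      x m hm ≫ X.map g = x m' hm' := by
    by_cases hid : MorphismProperty.identities B g
    · cases hid
      obtain rfl : m = m' := by simpa using e
      simp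
    · subst e
      exact hx m hm g ⟨hg, hid⟩ hm'
  refine ⟨limit.lift (matchingForget W b ⋙ X) ⟨P, { app := fun j => x j.hom j.prop
                                                    naturality := fun i j g => ?_ }⟩,
    fun m hm => limit.lift_π _ (MorphismProperty.Under.mk W m hm)⟩
  exact (Category.id_comp _).trans (hx' g.right g.prop_hom_right i.hom i.prop j.hom j.prop
    (MorphismProperty.Under.w g)).symm

end Matching

end ElementsOfLatchingAndMatching

section ReedyLifting

variable {B : Type w} [SmallCategory B] {C : Type u} [Category.{v} C]
  {W₁ W₂ : MorphismProperty B} [W₁.IsMultiplicative] [W₂.IsMultiplicative]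
  {D : Type t} [LinearOrder D] [OrderBot D] [SuccOrder D] [WellFoundedLT D]
  (r : ReedyStructure W₁ W₂ D)

include r

lemma deg_lt_of_nonIdentities₁ {b c : B} {m : b ⟶ c} (hm : nonIdentities W₁ m) :
    r.deg c < r.deg b := r.lt₁ m hm.1 hm.2

lemma deg_lt_of_nonIdentities₂ {b c : B} {m : b ⟶ c} (hm : nonIdentities W₂ m) :
    r.deg b < r.deg c := r.lt₂ m hm.1 hm.2

lemma not_identities_of_deg_ne {b c : B} (m : b ⟶ c) (h : r.deg b ≠ r.deg c) :
    ¬ MorphismProperty.identities B m := by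
  rintro ⟨_⟩
  exact h rfl

lemma nonIdentities₁_comp {b c d : B} {m : b ⟶ c} {n : c ⟶ d} (hm : nonIdentities W₁ m)
    (hn : W₁ n) : nonIdentities W₁ (m ≫ n) :=
  ⟨W₁.comp_mem _ _ hm.1 hn, not_identities_of_deg_ne r _
    ((r.le₁ n hn).trans_lt (deg_lt_of_nonIdentities₁ r hm)).ne'⟩

lemma nonIdentities₂_comp {b c d : B} {m : b ⟶ c} {n : c ⟶ d} (hm : W₂ m)
    (hn : nonIdentities W₂ n) : nonIdentities W₂ (m ≫ n) :=
  ⟨W₂.comp_mem _ _ hm hn.1, not_identities_of_deg_ne r _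
    ((r.le₂ m hm).trans_lt (deg_lt_of_nonIdentities₂ r hn)).ne⟩

/-- A family of morphisms defined in low degrees which is natural with respect to the
nonidentity morphisms of the inverse and direct parts is natural. -/
lemma natural_of_nonIdentities {Y P : B ⥤ C} (S : B → Prop)
    (hS : ∀ c d, r.deg d ≤ r.deg c → S c → S d) (l : ∀ c, S c → (Y.obj c ⟶ P.obj c))
    (h₁ : ∀ {c d} (g : c ⟶ d), nonIdentities W₁ g → ∀ hc hd,
      Y.map g ≫ l d hd = l c hc ≫ P.map g)
    (h₂ : ∀ {c d} (g : c ⟶ d), nonIdentities W₂ g → ∀ hc hd,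
      Y.map g ≫ l d hd = l c hc ≫ P.map g)
    {c d : B} (g : c ⟶ d) (hc : S c) (hd : S d) :
    Y.map g ≫ l d hd = l c hc ≫ P.map g := by
  have h₁' {c d} (g : c ⟶ d) (hg : W₁ g) (hc hd) : Y.map g ≫ l d hd = l c hc ≫ P.map g := by
    by_cases hid : MorphismProperty.identities B g
    · cases hid; simp
    · exact h₁ g ⟨hg, hid⟩ hc hd
  have h₂' {c d} (g : c ⟶ d) (hg : W₂ g) (hc hd) : Y.map g ≫ l d hd = l c hc ≫ P.map g := by
    by_cases hid : MorphismProperty.identities B g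
    · cases hid; simp
    · exact h₂ g ⟨hg, hid⟩ hc hd
  obtain ⟨e, g₁, g₂, hg₁, hg₂, rfl, -⟩ := r.exists_fac g
  have he : S e := hS c e (r.le₁ g₁ hg₁) hc
  rw [Y.map_comp, P.map_comp, Category.assoc, h₂' g₂ hg₂ he hd, ← Category.assoc,
    h₁' g₁ hg₁ hc he, Category.assoc]

variable [HasColimitsOfSize.{w, w} C] [HasLimitsOfSize.{w, w} C]
  [HasPushouts C] [HasPullbacks C]

/-- If every relative latching morphism of `f` lifts against the corresponding relative matching
morphism of `p`, then `f` lifts against `p`. -/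
theorem hasLiftingProperty_of_relativeLatchingMap_relativeMatchingMap
    {X Y P Q : B ⥤ C} (f : X ⟶ Y) (p : P ⟶ Q)
    (h : ∀ b, HasLiftingProperty (relativeLatchingMap W₂ f b) (relativeMatchingMap W₁ p b)) :
    HasLiftingProperty f p := by
  refine ⟨fun {u q} sq => ?_⟩
  have w (b : B) : u.app b ≫ p.app b = f.app b ≫ q.app b := congr_app sq.w b
  let Good (b : B) (l : ∀ c, r.deg c < r.deg b → (Y.obj c ⟶ P.obj c))
      (x : Y.obj b ⟶ P.obj b) : Prop :=
    f.app b ≫ x = u.app b ∧ x ≫ p.app b = q.app b ∧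
      (∀ {c} (g : c ⟶ b) (hg : nonIdentities W₂ g),
        Y.map g ≫ x = l c (deg_lt_of_nonIdentities₂ r hg) ≫ P.map g) ∧
      (∀ {c} (g : b ⟶ c) (hg : nonIdentities W₁ g),
        Y.map g ≫ l c (deg_lt_of_nonIdentities₁ r hg) = x ≫ P.map g)
  obtain ⟨l, hl⟩ := exists_forall_of_wellFounded
    (InvImage.wf r.deg (wellFounded_lt (α := D))) (T := fun b => (Y.obj b ⟶ P.obj b)) Good
    (fun h₁ h₂ => lt_trans h₁ h₂) (fun b l hl => by
      have nat {c d : B} (g : c ⟶ d) (hc : r.deg c < r.deg b) (hd : r.deg d < r.deg b) :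
          Y.map g ≫ l d hd = l c hc ≫ P.map g :=
        natural_of_nonIdentities r (fun c => r.deg c < r.deg b)
          (fun c d h₁ h₂ => h₁.trans_lt h₂) l (fun g hg hc hd => (hl _ hc).2.2.2 g hg)
          (fun g hg hc hd => (hl _ hd).2.2.1 g hg) g hc hd
      have hL {c : B} {m : c ⟶ b} (hm : nonIdentities W₂ m) : r.deg c < r.deg b :=
        deg_lt_of_nonIdentities₂ r hm
      have hM {c : B} {m : b ⟶ c} (hm : nonIdentities W₁ m) : r.deg c < r.deg b :=
        deg_lt_of_nonIdentities₁ r hm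
      obtain ⟨y, hy⟩ := exists_latchingι_comp_eq W₂ Y (b := b)
        (fun {c} m hm => l c (hL hm) ≫ P.map m) (fun g _ m hm hm' => by
          rw [← Category.assoc, nat g (hL hm') (hL hm), Category.assoc, ← P.map_comp])
      obtain ⟨z, hz⟩ := exists_comp_matchingπ_eq W₁ P (b := b)
        (fun {c} m hm => Y.map m ≫ l c (hM hm)) (fun m hm g _ hm' => by
          rw [Category.assoc, ← nat g (hM hm) (hM hm'), ← Category.assoc, ← Y.map_comp])
      have hz' : z ≫ matchingObjMap W₁ p b = q.app b ≫ matchingMap W₁ Q b := by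
        apply matchingObj_hom_ext
        intro c m hm
        rw [Category.assoc, Category.assoc, matchingObjMap_matchingπ, matchingMap_matchingπ,
          reassoc_of% (hz m hm), (hl _ (hM hm)).2.1]
        exact q.naturality _
      obtain ⟨x, hx₁, hx₂, hx₃⟩ := (hasLiftingProperty_pushoutDesc_iff _ _).1 (h b) (u.app b) y
        (pullback.lift z (q.app b) hz') (by
          apply latchingObj_hom_ext
          intro c m hm
          rw [reassoc_of% @latchingι_latchingMap, reassoc_of% @latchingι_latchingObjMap, hy,
            ← Category.assoc, (hl _ (hL hm)).1]
          exact u.naturality _) (by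
          apply pullback.hom_ext
          · rw [Category.assoc, Category.assoc, relativeMatchingMap, pullback.lift_fst,
              pullback.lift_fst]
            apply matchingObj_hom_ext
            intro c m hm
            rw [Category.assoc, Category.assoc, matchingMap_matchingπ, hz,
              ← Category.assoc, ← f.naturality, Category.assoc, (hl _ (hM hm)).1]
            exact (u.naturality _).symm
          · rw [Category.assoc, Category.assoc, relativeMatchingMap, pullback.lift_snd,
              pullback.lift_snd, w]) (by
          apply latchingObj_hom_ext
          intro c m hm
          rw [reassoc_of% @latchingι_latchingMap, reassoc_of% (hy m hm)]
          apply pullback.hom_ext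
          · simp only [Category.assoc, relativeMatchingMap]
            rw [pullback.lift_fst, pullback.lift_fst]
            apply matchingObj_hom_ext
            intro d n hn
            simp only [Category.assoc]
            rw [matchingMap_matchingπ, hz, ← P.map_comp,
              ← nat (m ≫ n) (hL hm) (hM hn), Y.map_comp, Category.assoc]
          · simp only [Category.assoc, relativeMatchingMap]
            rw [pullback.lift_snd, pullback.lift_snd, p.naturality, ← Category.assoc,
              (hl _ (hL hm)).2.1]
            exact (q.naturality _).symm)
      rw [relativeMatchingMap] at hx₃
      have hx₄ := hx₃ =≫ pullback.fst _ _
      have hx₅ := hx₃ =≫ pullback.snd _ _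
      rw [Category.assoc, pullback.lift_fst, pullback.lift_fst] at hx₄
      rw [Category.assoc, pullback.lift_snd, pullback.lift_snd] at hx₅
      refine ⟨x, hx₁, hx₅, fun g hg => ?_, fun g hg => ?_⟩
      · have := latchingι W₂ Y g hg ≫= hx₂
        rwa [reassoc_of% @latchingι_latchingMap, hy] at this
      · have := hx₄ =≫ matchingπ W₁ P g hg
        rw [Category.assoc, matchingMap_matchingπ, hz] at this
        exact this.symm)
  refine ⟨⟨{ l := { app := l, naturality := fun c d g => ?_ }, fac_left := ?_, fac_right := ?_ }⟩⟩
  · exact natural_of_nonIdentities r (fun _ => True) (fun _ _ _ _ => trivial) (fun c _ => l c)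
      (fun g hg _ _ => (hl _).2.2.2 g hg) (fun g hg _ _ => (hl _).2.2.1 g hg) g trivial trivial
  · ext b
    exact (hl b).1
  · ext b
    exact (hl b).2.1

omit [HasColimitsOfSize.{w, w} C] [HasPushouts C] in
/-- If `f` lifts against the relative matching morphisms of `p` at all objects `c` such that there
is a nonidentity morphism `b ⟶ c` of the inverse part, then `f` lifts against `M^b p`. -/
theorem hasLiftingProperty_matchingObjMap {X Y : C} (f : X ⟶ Y) {P Q : B ⥤ C} (p : P ⟶ Q) (b : B)
    (h : ∀ {c} (m : b ⟶ c), nonIdentities W₁ m →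
      HasLiftingProperty f (relativeMatchingMap W₁ p c)) :
    HasLiftingProperty f (matchingObjMap W₁ p b) := by
  refine ⟨fun {u q} sq => ?_⟩
  let Good (k : Σ c, { m : b ⟶ c // nonIdentities W₁ m })
      (l : ∀ i : Σ c, { m : b ⟶ c // nonIdentities W₁ m }, r.deg i.1 < r.deg k.1 →
        (Y ⟶ P.obj i.1)) (x : Y ⟶ P.obj k.1) : Prop :=
    f ≫ x = u ≫ matchingπ W₁ P k.2.1 k.2.2 ∧ x ≫ p.app k.1 = q ≫ matchingπ W₁ Q k.2.1 k.2.2 ∧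
      ∀ {c} (n : k.1 ⟶ c) (hn : nonIdentities W₁ n),
        x ≫ P.map n = l ⟨c, k.2.1 ≫ n, nonIdentities₁_comp r k.2.2 hn.1⟩
          (deg_lt_of_nonIdentities₁ r hn)
  obtain ⟨l, hl⟩ := exists_forall_of_wellFounded
    (InvImage.wf (fun k : Σ c, { m : b ⟶ c // nonIdentities W₁ m } => r.deg k.1)
      (wellFounded_lt (α := D)))
    (T := fun k => (Y ⟶ P.obj k.1)) Good (fun h₁ h₂ => lt_trans h₁ h₂) (fun k l hl => by
      obtain ⟨k, m, hm⟩ := k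
      let l' {c : B} (n : k ⟶ c) (hn : nonIdentities W₁ n) : Y ⟶ P.obj c :=
        l ⟨c, m ≫ n, nonIdentities₁_comp r hm hn.1⟩ (deg_lt_of_nonIdentities₁ r hn)
      have hl' {c : B} (n : k ⟶ c) (hn : nonIdentities W₁ n) :=
        hl ⟨c, m ≫ n, nonIdentities₁_comp r hm hn.1⟩ (deg_lt_of_nonIdentities₁ r hn)
      obtain ⟨y, hy⟩ := exists_comp_matchingπ_eq W₁ P l' (fun n hn g hg hm' => by
        refine ((hl' n hn).2.2 g hg).trans ?_
        dsimp only [l']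
        congr 3
        exact Category.assoc _ _ _)
      obtain ⟨x, hx₁, hx₂, hx₃⟩ := (hasLiftingProperty_pullbackLift_iff _ _).1 (h m hm)
        (u ≫ matchingπ W₁ P m hm) y (q ≫ matchingπ W₁ Q m hm) (by
          apply matchingObj_hom_ext
          intro c n hn
          rw [Category.assoc, matchingObjMap_matchingπ, reassoc_of% (hy n hn),
            Category.assoc, Category.assoc, matchingMap_matchingπ,
            matchingπ_map _ _ _ _ _ hn.1 (nonIdentities₁_comp r hm hn.1)]
          exact (hl' n hn).2.1) (by
          apply matchingObj_hom_ext
          intro c n hn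
          rw [Category.assoc, Category.assoc, matchingMap_matchingπ, Category.assoc, hy,
            matchingπ_map _ _ _ _ _ hn.1 (nonIdentities₁_comp r hm hn.1)]
          exact (hl' n hn).1.symm) (by
          rw [Category.assoc, ← matchingObjMap_matchingπ, ← Category.assoc, sq.w,
            Category.assoc])
      refine ⟨x, hx₁, hx₃, fun n hn => ?_⟩
      have := hx₂ =≫ matchingπ W₁ P n hn
      rwa [Category.assoc, matchingMap_matchingπ, hy] at this)
  obtain ⟨y, hy⟩ := exists_comp_matchingπ_eq W₁ P (b := b) (fun {c} m hm => l ⟨c, m, hm⟩)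
    (fun m hm g hg _ => (hl ⟨_, m, hm⟩).2.2 g hg)
  refine ⟨⟨{ l := y, fac_left := ?_, fac_right := ?_ }⟩⟩
  · apply matchingObj_hom_ext
    intro c m hm
    rw [Category.assoc, hy, (hl ⟨_, m, hm⟩).1]
  · apply matchingObj_hom_ext
    intro c m hm
    rw [Category.assoc, matchingObjMap_matchingπ, reassoc_of% (hy m hm), (hl ⟨_, m, hm⟩).2.1]

end ReedyLifting

end ReedyDiagrams

namespace ReedyDiagrams

open Opposite

section Boundary

variable {A : Type w} [SmallCategory A] (W₂ : MorphismProperty A) [W₂.IsMultiplicative]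

/-- The element of `∂y(a)` represented by `x ⟶ c ⟶ a`, where `c ⟶ a` is a nonidentity morphism
of `W₂`. -/
noncomputable def boundaryElement {a c : A} (m : c ⟶ a) (hm : nonIdentities W₂ m) {x : A}
    (θ : x ⟶ c) : (boundary W₂ a).obj (op x) :=
  (latchingι W₂ (yoneda : A ⥤ Aᵒᵖ ⥤ Type w) m hm).app (op x) θ

lemma boundaryMap_boundaryElement {a c : A} (m : c ⟶ a) (hm : nonIdentities W₂ m) {x : A}
    (θ : x ⟶ c) :
    (boundaryMap W₂ a).app (op x) (boundaryElement W₂ m hm θ) = θ ≫ m :=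
  ConcreteCategory.congr_hom
    (congr_app (latchingι_latchingMap W₂ (yoneda : A ⥤ Aᵒᵖ ⥤ Type w) m hm) (op x)) θ

lemma boundary_map_boundaryElement {a c : A} (m : c ⟶ a) (hm : nonIdentities W₂ m) {x y : A}
    (g : y ⟶ x) (θ : x ⟶ c) :
    (boundary W₂ a).map g.op (boundaryElement W₂ m hm θ) = boundaryElement W₂ m hm (g ≫ θ) :=
  (ConcreteCategory.congr_hom
    ((latchingι W₂ (yoneda : A ⥤ Aᵒᵖ ⥤ Type w) m hm).naturality g.op) θ).symm

lemma boundaryElement_comp {a c d : A} (g : c ⟶ d) (hg : W₂ g) (m : d ⟶ a)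
    (hm : nonIdentities W₂ m) (hm' : nonIdentities W₂ (g ≫ m)) {x : A} (θ : x ⟶ c) :
    boundaryElement W₂ (g ≫ m) hm' θ = boundaryElement W₂ m hm (θ ≫ g) :=
  (ConcreteCategory.congr_hom
    (congr_app (map_latchingι W₂ (yoneda : A ⥤ Aᵒᵖ ⥤ Type w) g hg m hm hm') (op x)) θ).symm

lemma exists_eq_boundaryElement {a x : A} (k : (boundary W₂ a).obj (op x)) :
    ∃ (c : A) (m : c ⟶ a) (hm : nonIdentities W₂ m) (θ : x ⟶ c),
      k = boundaryElement W₂ m hm θ := by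
  obtain ⟨j, θ, h⟩ := Types.jointly_surjective_of_isColimit
    (isColimitOfPreserves ((evaluation Aᵒᵖ (Type w)).obj (op x))
      (colimit.isColimit (latchingForget W₂ a ⋙ (yoneda : A ⥤ Aᵒᵖ ⥤ Type w)))) k
  exact ⟨j.left, j.hom, j.prop, θ, h.symm⟩

variable {W₂}
variable {W₁ : MorphismProperty A} [W₁.IsMultiplicative]
  {D : Type t} [LinearOrder D] [OrderBot D] [SuccOrder D] [WellFoundedLT D]
  (r : ReedyStructure W₁ W₂ D)

include r

lemma exists_eq_boundaryElement_of_prop {a x : A} (k : (boundary W₂ a).obj (op x)) :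
    ∃ (c : A) (m : c ⟶ a) (hm : nonIdentities W₂ m) (θ : x ⟶ c),
      W₁ θ ∧ k = boundaryElement W₂ m hm θ := by
  obtain ⟨c, m, hm, θ, rfl⟩ := exists_eq_boundaryElement W₂ k
  obtain ⟨d, θ₁, θ₂, h₁, h₂, rfl, -⟩ := r.exists_fac θ
  exact ⟨d, θ₂ ≫ m, nonIdentities₂_comp r h₂ hm, θ₁, h₁,
    (boundaryElement_comp W₂ θ₂ h₂ m hm _ θ₁).symm⟩

lemma eq_of_comp_eq_comp {x a c c' : A} {θ : x ⟶ c} {m : c ⟶ a} {θ' : x ⟶ c'} {m' : c' ⟶ a}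
    (hθ : W₁ θ) (hm : W₂ m) (hθ' : W₁ θ') (hm' : W₂ m') (h : θ ≫ m = θ' ≫ m') :
    ∃ e : c = c', θ' = θ ≫ eqToHom e ∧ m = eqToHom e ≫ m' := by
  obtain ⟨e, h₁, h₂⟩ := r.unique
    (MorphismProperty.MapFactorizationData.mk (f := θ ≫ m) (W₁ := W₁) (W₂ := W₂) c θ m rfl hθ hm)
    (MorphismProperty.MapFactorizationData.mk c' θ' m' h.symm hθ' hm')
  obtain rfl : c = c' := e
  refine ⟨rfl, ?_, by simpa using h₂⟩
  simpa using h₁.symm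

lemma boundaryMap_injective {a x : A} {k k' : (boundary W₂ a).obj (op x)}
    (h : (boundaryMap W₂ a).app (op x) k = (boundaryMap W₂ a).app (op x) k') : k = k' := by
  obtain ⟨c, m, hm, θ, hθ, rfl⟩ := exists_eq_boundaryElement_of_prop r k
  obtain ⟨c', m', hm', θ', hθ', rfl⟩ := exists_eq_boundaryElement_of_prop r k'
  rw [boundaryMap_boundaryElement, boundaryMap_boundaryElement] at h
  obtain ⟨rfl, h₁, h₂⟩ := eq_of_comp_eq_comp r hθ hm.1 hθ' hm'.1 h
  obtain rfl : θ' = θ := by simpa using h₁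
  obtain rfl : m = m' := by simpa using h₂
  rfl

end Boundary

section Boxdot

variable {A : Type w} [SmallCategory A] {M : Type u} [Category.{w} M] [HasColimits M]

/-- The inclusion `X ⟶ (K ⊡ X)_c` of the copy of `X` indexed by an element of `K_c`. -/
noncomputable def boxdotι (K : Aᵒᵖ ⥤ Type w) (X : M) {c : Aᵒᵖ} (k : K.obj c) :
    X ⟶ (((boxdot A M).obj K).obj X).obj c :=
  Sigma.ι (fun _ : K.obj c => X) k

lemma boxdotι_map (K : Aᵒᵖ ⥤ Type w) (X : M) {c d : Aᵒᵖ} (k : K.obj c) (g : c ⟶ d) :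
    boxdotι K X k ≫ (((boxdot A M).obj K).obj X).map g = boxdotι K X (K.map g k) :=
  (Sigma.ι_comp_map' _ _ _).trans (Category.id_comp _)

lemma boxdotι_map_app {K K' : Aᵒᵖ ⥤ Type w} (θ : K ⟶ K') (X : M) {c : Aᵒᵖ} (k : K.obj c) :
    boxdotι K X k ≫ (((boxdot A M).map θ).app X).app c = boxdotι K' X (θ.app c k) :=
  (Sigma.ι_comp_map' _ _ _).trans (Category.id_comp _)

lemma boxdotι_obj_map_app (K : Aᵒᵖ ⥤ Type w) {X Y : M} (f : X ⟶ Y) {c : Aᵒᵖ} (k : K.obj c) :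
    boxdotι K X k ≫ (((boxdot A M).obj K).map f).app c = f ≫ boxdotι K Y k :=
  Sigma.ι_map (fun _ : K.obj c => f) k

lemma boxdot_hom_ext {K : Aᵒᵖ ⥤ Type w} {X : M} {c : Aᵒᵖ} {P : M}
    {f g : (((boxdot A M).obj K).obj X).obj c ⟶ P}
    (h : ∀ k : K.obj c, boxdotι K X k ≫ f = boxdotι K X k ≫ g) : f = g :=
  Sigma.hom_ext _ _ h

lemma exists_boxdotι_comp_eq (K : Aᵒᵖ ⥤ Type w) (X : M) {c : Aᵒᵖ} {P : M}
    (x : K.obj c → (X ⟶ P)) :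
    ∃ y : (((boxdot A M).obj K).obj X).obj c ⟶ P, ∀ k, boxdotι K X k ≫ y = x k :=
  ⟨Sigma.desc x, fun k => Sigma.ι_desc x k⟩

lemma exists_boxdotι_comp_app_eq (K : Aᵒᵖ ⥤ Type w) (X : M) {P : Aᵒᵖ ⥤ M}
    (x : ∀ {c : Aᵒᵖ}, K.obj c → (X ⟶ P.obj c))
    (hx : ∀ {c d : Aᵒᵖ} (g : c ⟶ d) (k : K.obj c), x k ≫ P.map g = x (K.map g k)) :
    ∃ y : ((boxdot A M).obj K).obj X ⟶ P, ∀ {c} (k : K.obj c), boxdotι K X k ≫ y.app c = x k := by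
  choose y hy using fun c => exists_boxdotι_comp_eq K X (P := P.obj c) x
  refine ⟨{ app := y, naturality := fun c d g => ?_ }, fun {c} => hy c⟩
  apply boxdot_hom_ext
  intro k
  rw [reassoc_of% boxdotι_map K X k g, hy, reassoc_of% hy c k, hx]

lemma boxdotι_yoneda (a : A) (X : M) {c : A} (k : c ⟶ a) :
    boxdotι (yoneda.obj a) X (c := op c) k = boxdotι (yoneda.obj a) X (c := op a) (𝟙 a) ≫
      (((boxdot A M).obj (yoneda.obj a)).obj X).map k.op := by
  rw [boxdotι_map]
  congr 1
  exact (Category.comp_id k).symm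

end Boxdot

section MatchingFunctor

variable {B : Type w} [SmallCategory B] {C : Type u} [Category.{v} C]
  (W : MorphismProperty B) [W.IsMultiplicative] [HasLimitsOfSize.{w, w} C]

/-- The functor sending `X` to the matching object `M^b X`. -/
noncomputable def matchingFunctor (b : B) : (B ⥤ C) ⥤ C where
  obj X := matchingObj W X b
  map φ := matchingObjMap W φ b
  map_id X := by
    apply matchingObj_hom_ext
    intro c m hm
    rw [matchingObjMap_matchingπ]
    simp
  map_comp φ ψ := by
    apply matchingObj_hom_ext
    intro c m hm
    rw [Category.assoc, matchingObjMap_matchingπ, matchingObjMap_matchingπ,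
      reassoc_of% @matchingObjMap_matchingπ, NatTrans.comp_app]

/-- The natural transformation with components `X_b ⟶ M^b X`. -/
noncomputable def evaluationToMatchingFunctor (b : B) :
    (evaluation B C).obj b ⟶ matchingFunctor W b where
  app X := matchingMap W X b
  naturality _ _ φ := (matchingMap_naturality W φ b).symm

variable [HasColimitsOfSize.{w, w} C]

/-- The functor sending `X` to the latching object `L_b X`. -/
noncomputable def latchingFunctor (b : B) : (B ⥤ C) ⥤ C where
  obj X := latchingObj W X b
  map φ := latchingObjMap W φ b
  map_id X := by
    apply latchingObj_hom_ext
    intro c m hm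
    rw [latchingι_latchingObjMap]
    simp
  map_comp φ ψ := by
    apply latchingObj_hom_ext
    intro c m hm
    rw [latchingι_latchingObjMap, reassoc_of% @latchingι_latchingObjMap,
      latchingι_latchingObjMap, NatTrans.comp_app, Category.assoc]

/-- The natural transformation with components `L_b X ⟶ X_b`. -/
noncomputable def latchingFunctorToEvaluation (b : B) :
    latchingFunctor W b ⟶ (evaluation B C).obj b where
  app X := latchingMap W X b
  naturality _ _ φ := (latchingMap_naturality W φ b).symm

end MatchingFunctor

section Adjunctions

/-- An adjunction defined by natural bijections. -/
noncomputable def adjunctionOfBijective {C D : Type*} [Category* C] [Category* D] {G : C ⥤ D}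
    {G' : D ⥤ C} (η : ∀ {X : C} {P : D}, (G.obj X ⟶ P) → (X ⟶ G'.obj P))
    (bij : ∀ (X : C) (P : D), Function.Bijective (η (X := X) (P := P)))
    (naturality_left : ∀ {X X' : C} {P : D} (f : X ⟶ X') (φ : G.obj X' ⟶ P),
      η (G.map f ≫ φ) = f ≫ η φ)
    (naturality_right : ∀ {X : C} {P P' : D} (φ : G.obj X ⟶ P) (g : P ⟶ P'),
      η (φ ≫ g) = η φ ≫ G'.map g) : G ⊣ G' :=
  Adjunction.mkOfHomEquiv
    { homEquiv := fun X P => Equiv.ofBijective η (bij X P)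
      homEquiv_naturality_left_symm := fun {X X' P} f g => by
        rw [Equiv.symm_apply_eq, Equiv.ofBijective_apply, naturality_left]
        exact congrArg (f ≫ ·) ((Equiv.ofBijective η (bij X' P)).apply_symm_apply g).symm
      homEquiv_naturality_right := fun φ g => naturality_right φ g }

lemma adjunctionOfBijective_homEquiv {C D : Type*} [Category* C] [Category* D] {G : C ⥤ D}
    {G' : D ⥤ C} (η : ∀ {X : C} {P : D}, (G.obj X ⟶ P) → (X ⟶ G'.obj P))
    (bij naturality_left naturality_right) (X : C) (P : D) (φ : G.obj X ⟶ P) :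
    (adjunctionOfBijective η bij naturality_left naturality_right).homEquiv X P φ = η φ := by
  rw [adjunctionOfBijective, Adjunction.mkOfHomEquiv_homEquiv, Equiv.ofBijective_apply]

variable {A : Type w} [SmallCategory A] {M : Type u} [Category.{w} M] [HasColimits M]

/-- The functor `y(a) ⊡ -` is left adjoint to evaluation at `a`. -/
noncomputable def boxdotYonedaAdjunction (a : A) :
    (boxdot A M).obj (yoneda.obj a) ⊣ (evaluation Aᵒᵖ M).obj (op a) :=
  adjunctionOfBijective
    (fun {X P} φ => boxdotι (yoneda.obj a) X (c := op a) (𝟙 a) ≫ φ.app (op a))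
    (fun X P => by
      constructor
      · intro φ ψ h
        ext ⟨c⟩ : 2
        apply boxdot_hom_ext
        intro k
        rw [boxdotι_yoneda, Category.assoc, Category.assoc, φ.naturality, ψ.naturality,
          ← Category.assoc, ← Category.assoc]
        exact congrArg (· ≫ _) h
      · intro x
        obtain ⟨y, hy⟩ := exists_boxdotι_comp_app_eq (yoneda.obj a) X (P := P)
          (fun {c} k => x ≫ P.map (Quiver.Hom.op (V := A) k)) (fun g k => by
            rw [Category.assoc, ← P.map_comp]
            rfl)
        refine ⟨y, (hy _).trans ?_⟩
        exact (congrArg (x ≫ ·) (P.map_id (op a))).trans (Category.comp_id _))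
    (fun f φ => by rw [NatTrans.comp_app, reassoc_of% @boxdotι_obj_map_app])
    (fun φ g => (Category.assoc _ _ _).symm)

lemma boxdotYonedaAdjunction_homEquiv_apply (a : A) (X : M) (P : Aᵒᵖ ⥤ M)
    (φ : ((boxdot A M).obj (yoneda.obj a)).obj X ⟶ P) :
    (boxdotYonedaAdjunction a).homEquiv X P φ =
      boxdotι (yoneda.obj a) X (c := op a) (𝟙 a) ≫ φ.app (op a) :=
  adjunctionOfBijective_homEquiv _ _ _ _ _ _ _

variable (W₂ : MorphismProperty A) [W₂.IsMultiplicative]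

omit [W₂.IsMultiplicative] in
lemma nonIdentities_op_iff {a b : Aᵒᵖ} (m : a ⟶ b) :
    nonIdentities W₂.op m ↔ nonIdentities W₂ m.unop := by
  rw [nonIdentities, nonIdentities, MorphismProperty.identities_op_iff]
  rfl

variable [HasLimits M]

/-- The morphism `X ⟶ M^a P` corresponding to `∂y(a) ⊡ X ⟶ P`. -/
lemma exists_boundary_matchingLift (a : A) {X : M} {P : Aᵒᵖ ⥤ M}
    (φ : ((boxdot A M).obj (boundary W₂ a)).obj X ⟶ P) :
    ∃ y : X ⟶ matchingObj W₂.op P (op a), ∀ {c : A} (m : c ⟶ a) (hm : nonIdentities W₂ m),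
      y ≫ matchingπ W₂.op P m.op ((nonIdentities_op_iff W₂ m.op).2 hm) =
        boxdotι (boundary W₂ a) X (boundaryElement W₂ m hm (𝟙 c)) ≫ φ.app (op c) := by
  obtain ⟨y, hy⟩ := exists_comp_matchingπ_eq W₂.op P (b := op a)
    (fun {c} m hm => boxdotι (boundary W₂ a) X
      (boundaryElement W₂ m.unop ((nonIdentities_op_iff W₂ m).1 hm) (𝟙 c.unop)) ≫ φ.app c)
    (fun {c d} m hm g hg hm' => by
      rw [Category.assoc, ← φ.naturality, reassoc_of% @boxdotι_map]
      congr 2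
      refine (boundary_map_boundaryElement W₂ m.unop _ g.unop (𝟙 _)).trans ?_
      rw [Category.comp_id, ← Category.id_comp g.unop]
      exact (boundaryElement_comp W₂ g.unop hg.1 m.unop ((nonIdentities_op_iff W₂ m).1 hm)
        ((nonIdentities_op_iff W₂ (m ≫ g)).1 hm') (𝟙 _)).symm)
  exact ⟨y, fun m hm => hy m.op _⟩

/-- The functor `∂y(a) ⊡ -` is left adjoint to the matching object functor at `a`. -/
noncomputable def boxdotBoundaryAdjunction (a : A) :
    (boxdot A M).obj (boundary W₂ a) ⊣ matchingFunctor W₂.op (op a) :=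
  adjunctionOfBijective (fun φ => (exists_boundary_matchingLift W₂ a φ).choose)
    (fun X P => by
      constructor
      · intro φ ψ h
        ext ⟨c⟩ : 2
        apply boxdot_hom_ext
        intro k
        obtain ⟨d, m, hm, θ, rfl⟩ := exists_eq_boundaryElement W₂ k
        have e : boxdotι (boundary W₂ a) X (boundaryElement W₂ m hm θ) =
            boxdotι (boundary W₂ a) X (boundaryElement W₂ m hm (𝟙 d)) ≫
              (((boxdot A M).obj (boundary W₂ a)).obj X).map θ.op := by
          rw [boxdotι_map, boundary_map_boundaryElement, Category.comp_id]
        rw [e, Category.assoc, Category.assoc, φ.naturality, ψ.naturality,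
          ← Category.assoc, ← Category.assoc,
          ← (exists_boundary_matchingLift W₂ a φ).choose_spec m hm,
          ← (exists_boundary_matchingLift W₂ a ψ).choose_spec m hm]
        exact congrArg (fun y => (y ≫ _) ≫ _) h
      · intro y
        obtain ⟨F, hF⟩ := exists_latchingι_comp_eq W₂ (yoneda : A ⥤ Aᵒᵖ ⥤ Type w) (b := a)
          (P := P ⋙ coyoneda.obj (op X))
          (fun {c} m hm => yonedaEquiv.symm
            (y ≫ matchingπ W₂.op P m.op ((nonIdentities_op_iff W₂ m.op).2 hm)))
          (fun {c d} g hg m hm hm' => by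
            rw [yonedaEquiv_symm_naturality_left]
            congr 1
            refine (Category.assoc _ _ _).trans (congrArg (y ≫ ·) ?_)
            exact matchingπ_map W₂.op P m.op _ g.op hg.1 ((nonIdentities_op_iff W₂ _).2 hm'))
        have hF' {c x : A} (m : c ⟶ a) (hm : nonIdentities W₂ m) (θ : x ⟶ c) :
            F.app (op x) (boundaryElement W₂ m hm θ) =
              y ≫ matchingπ W₂.op P m.op ((nonIdentities_op_iff W₂ m.op).2 hm) ≫ P.map θ.op :=
          (ConcreteCategory.congr_hom (congr_app (hF m hm) (op x)) θ).trans (Category.assoc _ _ _)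
        obtain ⟨φ, hφ⟩ := exists_boxdotι_comp_app_eq (boundary W₂ a) X (P := P)
          (fun {c} k => F.app c k) (fun {c d} g k =>
            (ConcreteCategory.congr_hom (F.naturality g) k).symm)
        refine ⟨φ, ?_⟩
        apply matchingObj_hom_ext
        intro c m hm
        refine ((exists_boundary_matchingLift W₂ a φ).choose_spec m.unop
          ((nonIdentities_op_iff W₂ m).1 hm)).trans ?_
        refine (hφ _).trans ((hF' _ _ _).trans ?_)
        refine (congrArg (fun z => y ≫ _ ≫ z) (P.map_id _)).trans ?_
        exact congrArg (y ≫ ·) (Category.comp_id _))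
    (fun {X X' P} f φ => by
      apply matchingObj_hom_ext
      intro c m hm
      have h₁ := (exists_boundary_matchingLift W₂ a φ).choose_spec m.unop
        ((nonIdentities_op_iff W₂ m).1 hm)
      refine ((exists_boundary_matchingLift W₂ a _).choose_spec m.unop
        ((nonIdentities_op_iff W₂ m).1 hm)).trans ?_
      rw [NatTrans.comp_app, reassoc_of% @boxdotι_obj_map_app, ← h₁]
      exact (Category.assoc _ _ _).symm)
    (fun {X P P'} φ g => by
      apply matchingObj_hom_ext
      intro c m hm
      have h₁ := (exists_boundary_matchingLift W₂ a φ).choose_spec m.unop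
        ((nonIdentities_op_iff W₂ m).1 hm)
      refine ((exists_boundary_matchingLift W₂ a _).choose_spec m.unop
        ((nonIdentities_op_iff W₂ m).1 hm)).trans ?_
      rw [NatTrans.comp_app, ← Category.assoc, ← h₁, Category.assoc]
      refine Eq.trans ?_ (Category.assoc _ _ _).symm
      exact congrArg (_ ≫ ·) (matchingObjMap_matchingπ W₂.op g m hm).symm)

lemma boxdotBoundaryAdjunction_homEquiv_apply (a : A) (X : M) (P : Aᵒᵖ ⥤ M)
    (φ : ((boxdot A M).obj (boundary W₂ a)).obj X ⟶ P) {c : A} (m : c ⟶ a)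
    (hm : nonIdentities W₂ m) :
    (boxdotBoundaryAdjunction W₂ a).homEquiv X P φ ≫
        matchingπ W₂.op P m.op ((nonIdentities_op_iff W₂ m.op).2 hm) =
      boxdotι (boundary W₂ a) X (boundaryElement W₂ m hm (𝟙 c)) ≫ φ.app (op c) := by
  refine Eq.trans (congrArg (fun y => y ≫ matchingπ W₂.op P m.op _)
    (adjunctionOfBijective_homEquiv _ _ _ _ X P φ)) ?_
  exact (exists_boundary_matchingLift W₂ a φ).choose_spec m hm

/-- The pushout-product of `∂y(a) ⟶ y(a)` and `f` lifts against `p` if and only if `f` lifts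
against the relative matching morphism of `p` at `a`. -/
theorem hasLiftingProperty_boundaryPushoutProduct_iff (a : A) {X Y : M} (f : X ⟶ Y)
    {P Q : Aᵒᵖ ⥤ M} (p : P ⟶ Q) :
    HasLiftingProperty (boundaryPushoutProduct W₂ a f) p ↔
      HasLiftingProperty f (relativeMatchingMap W₂.op p (op a)) :=
  hasLiftingProperty_leibniz_iff (boxdotBoundaryAdjunction W₂ a) (boxdotYonedaAdjunction a)
    ((boxdot A M).map (boundaryMap W₂ a)) (evaluationToMatchingFunctor W₂.op (op a))
    (fun X P φ => by
      apply matchingObj_hom_ext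
      intro c m hm
      refine (boxdotBoundaryAdjunction_homEquiv_apply W₂ a X P _ m.unop
        ((nonIdentities_op_iff W₂ m).1 hm)).trans ?_
      rw [NatTrans.comp_app, reassoc_of% @boxdotι_map_app, boundaryMap_boundaryElement,
        Category.id_comp, boxdotι_yoneda, boxdotYonedaAdjunction_homEquiv_apply, Category.assoc,
        φ.naturality]
      refine Eq.trans ?_ (Category.assoc _ _ _).symm
      refine (Category.assoc _ _ _).symm.trans ?_
      exact congrArg (_ ≫ ·) (matchingMap_matchingπ W₂.op P m hm).symm) f p

end Adjunctions

end ReedyDiagrams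

namespace ReedyDiagrams

open Opposite

section SmallObjectArgument

/-- In a locally presentable category, any small set of morphisms permits the small object
argument. -/
lemma hasSmallObjectArgument_of_isLocallyPresentable {C : Type u} [Category.{v} C]
    [IsLocallyPresentable.{w} C] (I : MorphismProperty C) [MorphismProperty.IsSmall.{w} I] :
    MorphismProperty.HasSmallObjectArgument.{w} I := by
  obtain ⟨κ₀, _, _⟩ := IsLocallyPresentable.exists_cardinal.{w} C
  have hI (i : Shrink.{w} I.toSet) : ∃ (κ : Cardinal.{w}) (_ : Fact κ.IsRegular),
      IsCardinalPresentable ((equivShrink _).symm i).1.left κ :=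
    Functor.IsAccessible.exists_cardinal
      (F := coyoneda.obj (op ((equivShrink I.toSet).symm i).1.left))
  choose κ hκ hκ' using hI
  obtain ⟨κ', h₁, h₂⟩ := HasCardinalLT.exists_regular_cardinal_forall.{w}
    (fun i => (κ i).ord.ToType)
  have : Fact κ'.IsRegular := ⟨h₁⟩
  have : Nonempty κ'.ord.ToType := by simpa using h₁.ne_zero
  have := WellFoundedLT.toOrderBot κ'.ord.ToType
  refine ⟨κ', inferInstance, inferInstance, { preservesColimit := fun {X Y _ _} i hi f hf => ?_ }⟩
  have : IsCardinalPresentable X κ' := by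
    have h := h₂ (equivShrink _ ⟨Arrow.mk i, hi⟩)
    rw [hasCardinalLT_iff_cardinal_mk_lt, Cardinal.mk_toType, Cardinal.card_ord] at h
    have : IsCardinalPresentable X (κ (equivShrink _ ⟨Arrow.mk i, hi⟩)) := by
      have := hκ' (equivShrink _ ⟨Arrow.mk i, hi⟩)
      rwa [Equiv.symm_apply_apply] at this
    exact isCardinalPresentable_of_le X h.le
  have := preservesColimitsOfShape_of_isCardinalPresentable X κ' κ'.ord.ToType
  infer_instance

end SmallObjectArgument

section LatchingAdjunction

variable {B : Type w} [SmallCategory B] {C : Type u} [Category.{v} C]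
  (W : MorphismProperty B) [W.IsMultiplicative]
  [HasLimitsOfSize.{w, w} C] [HasColimitsOfSize.{w, w} C]

instance latchingFunctor_isLeftAdjoint (b : B) :
    (latchingFunctor W b : (B ⥤ C) ⥤ C).IsLeftAdjoint :=
  (((latchingForget W b).ranAdjunction C).comp colimConstAdj).isLeftAdjoint

/-- If all the relative latching morphisms at `b` of elements of `K` lift against `p`, so do the
relative latching morphisms at `b` of elements of `K.rlp.llp`. -/
theorem hasLiftingProperty_relativeLatchingMap_of_rlp_llp [HasPushouts C] [HasPullbacks C]
    (K : MorphismProperty (B ⥤ C)) (b : B) {P Q : C} (p : P ⟶ Q)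
    (hK : ∀ {X Y : B ⥤ C} (f : X ⟶ Y), K f → HasLiftingProperty (relativeLatchingMap W f b) p)
    {X Y : B ⥤ C} (f : X ⟶ Y) (hf : K.rlp.llp f) :
    HasLiftingProperty (relativeLatchingMap W f b) p := by
  let adjG := Adjunction.ofIsLeftAdjoint (latchingFunctor W b : (B ⥤ C) ⥤ C)
  let adjH := Adjunction.ofIsLeftAdjoint ((evaluation B C).obj b)
  let α' := conjugateEquiv adjH adjG (latchingFunctorToEvaluation W b)
  have compat (X : B ⥤ C) (P : C) (φ : ((evaluation B C).obj b).obj X ⟶ P) :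
      adjG.homEquiv X P ((latchingFunctorToEvaluation W b).app X ≫ φ) =
        adjH.homEquiv X P φ ≫ α'.app P := by
    rw [adjG.homEquiv_unit, adjH.homEquiv_unit, Functor.map_comp, Category.assoc,
      α'.naturality, ← Category.assoc, ← Category.assoc]
    exact congrArg (· ≫ _) (unit_conjugateEquiv adjH adjG (latchingFunctorToEvaluation W b) X).symm
  have key {X Y : B ⥤ C} (f : X ⟶ Y) :=
    hasLiftingProperty_leibniz_iff adjG adjH (latchingFunctorToEvaluation W b) α' compat f p
  exact (key f).2 (hf _ fun _ _ g hg => (key g).1 (hK g hg))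

end LatchingAdjunction

section LatchingOfPushoutProducts

variable {A : Type w} [SmallCategory A] {M : Type u} [Category.{w} M] [HasColimits M]
  {W₁ W₂ : MorphismProperty A} [W₁.IsMultiplicative] [W₂.IsMultiplicative]

variable (W₂) in
/-- The inclusion of `y(a) ⊡ X` in the domain of a pushout-product. -/
noncomputable abbrev boundaryPushoutProductInl (a : A) {X Y : M} (f : X ⟶ Y) :
    ((boxdot A M).obj (yoneda.obj a)).obj X ⟶
      pushout (((boxdot A M).map (boundaryMap W₂ a)).app X)
        (((boxdot A M).obj (boundary W₂ a)).map f) :=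
  pushout.inl _ _

variable (W₂) in
/-- The inclusion of `∂y(a) ⊡ Y` in the domain of a pushout-product. -/
noncomputable abbrev boundaryPushoutProductInr (a : A) {X Y : M} (f : X ⟶ Y) :
    ((boxdot A M).obj (boundary W₂ a)).obj Y ⟶
      pushout (((boxdot A M).map (boundaryMap W₂ a)).app X)
        (((boxdot A M).obj (boundary W₂ a)).map f) :=
  pushout.inr _ _

lemma boundaryPushoutProduct_hom_ext {a : A} {X Y : M} {f : X ⟶ Y} {b : Aᵒᵖ} {P : M}
    {x y : (pushout (((boxdot A M).map (boundaryMap W₂ a)).app X)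
        (((boxdot A M).obj (boundary W₂ a)).map f)).obj b ⟶ P}
    (h₁ : ∀ k, boxdotι _ _ k ≫ (boundaryPushoutProductInl W₂ a f).app b ≫ x =
      boxdotι _ _ k ≫ (boundaryPushoutProductInl W₂ a f).app b ≫ y)
    (h₂ : ∀ k, boxdotι _ _ k ≫ (boundaryPushoutProductInr W₂ a f).app b ≫ x =
      boxdotι _ _ k ≫ (boundaryPushoutProductInr W₂ a f).app b ≫ y) : x = y :=
  ((IsPushout.of_hasPushout (((boxdot A M).map (boundaryMap W₂ a)).app X)
    (((boxdot A M).obj (boundary W₂ a)).map f)).map ((evaluation Aᵒᵖ M).obj b)).hom_ext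
    (boxdot_hom_ext h₁) (boxdot_hom_ext h₂)

lemma boundaryPushoutProduct_condition (a : A) {X Y : M} (f : X ⟶ Y) {b : Aᵒᵖ}
    (k : (boundary W₂ a).obj b) :
    f ≫ boxdotι _ _ k ≫ (boundaryPushoutProductInr W₂ a f).app b =
      boxdotι _ _ ((boundaryMap W₂ a).app b k) ≫ (boundaryPushoutProductInl W₂ a f).app b := by
  rw [← reassoc_of% @boxdotι_obj_map_app, ← reassoc_of% @boxdotι_map_app]
  have h : ((boxdot A M).map (boundaryMap W₂ a)).app X ≫ boundaryPushoutProductInl W₂ a f =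
      ((boxdot A M).obj (boundary W₂ a)).map f ≫ boundaryPushoutProductInr W₂ a f :=
    pushout.condition
  exact congrArg (boxdotι _ _ k ≫ ·) (congr_app h b).symm

lemma boxdotι_inl_boundaryPushoutProduct (a : A) {X Y : M} (f : X ⟶ Y) {b : Aᵒᵖ}
    (k : (yoneda.obj a).obj b) :
    boxdotι _ _ k ≫ (boundaryPushoutProductInl W₂ a f).app b ≫
      (boundaryPushoutProduct W₂ a f).app b = f ≫ boxdotι _ _ k := by
  rw [← boxdotι_obj_map_app]
  have h : boundaryPushoutProductInl W₂ a f ≫ boundaryPushoutProduct W₂ a f =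
      ((boxdot A M).obj (yoneda.obj a)).map f := pushout.inl_desc _ _ _
  exact congrArg (boxdotι _ _ k ≫ ·) (congr_app h b)

lemma boxdotι_inr_boundaryPushoutProduct (a : A) {X Y : M} (f : X ⟶ Y) {b : Aᵒᵖ}
    (k : (boundary W₂ a).obj b) :
    boxdotι _ _ k ≫ (boundaryPushoutProductInr W₂ a f).app b ≫
      (boundaryPushoutProduct W₂ a f).app b = boxdotι _ _ ((boundaryMap W₂ a).app b k) := by
  rw [← boxdotι_map_app]
  have h : boundaryPushoutProductInr W₂ a f ≫ boundaryPushoutProduct W₂ a f =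
      ((boxdot A M).map (boundaryMap W₂ a)).app Y := pushout.inr_desc _ _ _
  exact congrArg (boxdotι _ _ k ≫ ·) (congr_app h b)

/-- Lifts against the component at `b` of a pushout-product can be defined componentwise. -/
lemma exists_lift_of_components (a : A) {X Y : M} (f : X ⟶ Y) (b : Aᵒᵖ) {P Q : M} {p : P ⟶ Q}
    {x : (pushout (((boxdot A M).map (boundaryMap W₂ a)).app X)
        (((boxdot A M).obj (boundary W₂ a)).map f)).obj b ⟶ P}
    {q : (((boxdot A M).obj (yoneda.obj a)).obj Y).obj b ⟶ Q}
    (R : ∀ _ : (yoneda.obj a).obj b, (Y ⟶ P) → Prop)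
    (h : ∀ k : (yoneda.obj a).obj b, ∃ l : Y ⟶ P,
      f ≫ l = boxdotι _ _ k ≫ (boundaryPushoutProductInl W₂ a f).app b ≫ x ∧
      l ≫ p = boxdotι _ _ k ≫ q ∧
      (∀ k', (boundaryMap W₂ a).app b k' = k →
        l = boxdotι _ _ k' ≫ (boundaryPushoutProductInr W₂ a f).app b ≫ x) ∧ R k l) :
    ∃ l, (boundaryPushoutProduct W₂ a f).app b ≫ l = x ∧ l ≫ p = q ∧
      ∀ k, R k (boxdotι _ _ k ≫ l) := by
  choose l h₁ h₂ h₃ h₄ using h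
  obtain ⟨y, hy⟩ := exists_boxdotι_comp_eq (yoneda.obj a) Y l
  refine ⟨y, boundaryPushoutProduct_hom_ext (fun k => ?_) (fun k => ?_), boxdot_hom_ext fun k => ?_,
    fun k => ?_⟩
  · rw [reassoc_of% @boxdotι_inl_boundaryPushoutProduct, hy, h₁]
  · rw [reassoc_of% @boxdotι_inr_boundaryPushoutProduct, hy]
    exact h₃ _ k rfl
  · rw [reassoc_of% hy, h₂]
  · rw [hy]
    exact h₄ k

variable {D : Type t} [LinearOrder D] [OrderBot D] [SuccOrder D] [WellFoundedLT D]
  (r : ReedyStructure W₁ W₂ D)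

include r

/-- The components of pushout-products with `f` lift against all the morphisms against which
`f` lifts. -/
theorem hasLiftingProperty_boundaryPushoutProduct_app (a : A) {X Y : M} (f : X ⟶ Y) (b : Aᵒᵖ)
    {P Q : M} (p : P ⟶ Q) [HasLiftingProperty f p] :
    HasLiftingProperty ((boundaryPushoutProduct W₂ a f).app b) p := by
  refine ⟨fun {x q} sq => ?_⟩
  obtain ⟨l, h₁, h₂, -⟩ := exists_lift_of_components a f b (p := p) (x := x) (q := q)
    (fun _ _ => True) (fun k => by
      by_cases hk : ∃ k', (boundaryMap W₂ a).app b k' = k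
      · obtain ⟨k, rfl⟩ := hk
        refine ⟨boxdotι _ _ k ≫ (boundaryPushoutProductInr W₂ a f).app b ≫ x, ?_, ?_,
          fun k' h => ?_, trivial⟩
        · rw [reassoc_of% @boundaryPushoutProduct_condition]
        · rw [Category.assoc, Category.assoc, sq.w,
            reassoc_of% @boxdotι_inr_boundaryPushoutProduct]
        · rw [boundaryMap_injective r h]
      · have sq' : CommSq (boxdotι _ _ k ≫ (boundaryPushoutProductInl W₂ a f).app b ≫ x) f p
            (boxdotι _ _ k ≫ q) := ⟨by
          rw [Category.assoc, Category.assoc, sq.w,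
            reassoc_of% @boxdotι_inl_boundaryPushoutProduct]⟩
        exact ⟨sq'.lift, sq'.fac_left, sq'.fac_right, fun k' h => (hk ⟨k', h⟩).elim, trivial⟩)
  exact ⟨⟨l, h₁, h₂⟩⟩

/-- The relative latching morphisms of pushout-products with `f` lift against all the morphisms
against which `f` lifts. -/
theorem hasLiftingProperty_relativeLatchingMap_boundaryPushoutProduct [HasLimits M] (a : A)
    {X Y : M} (f : X ⟶ Y) (b : A) {P Q : M} (p : P ⟶ Q) [HasLiftingProperty f p] :
    HasLiftingProperty
      (relativeLatchingMap W₁.op (boundaryPushoutProduct W₂ a f) (op b)) p := by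
  rw [relativeLatchingMap, hasLiftingProperty_pushoutDesc_iff]
  intro x y q h₁ h₂ h₃
  let N := ((boxdot A M).obj (yoneda.obj a)).obj Y
  let yc {c : A} (m : b ⟶ c) (hm : nonIdentities W₁ m) (k : c ⟶ a) : Y ⟶ P :=
    boxdotι (yoneda.obj a) Y (c := op c) k ≫
      latchingι W₁.op N m.op ((nonIdentities_op_iff W₁ m.op).2 hm) ≫ y
  have yc_map {c d : A} (m : b ⟶ c) (hm : nonIdentities W₁ m) (g : c ⟶ d) (hg : W₁ g)
      (hm' : nonIdentities W₁ (m ≫ g)) (k : d ⟶ a) : yc (m ≫ g) hm' k = yc m hm (g ≫ k) := by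
    have := map_latchingι W₁.op N (b := op b) g.op hg m.op
      ((nonIdentities_op_iff W₁ m.op).2 hm) ((nonIdentities_op_iff W₁ (m ≫ g).op).2 hm')
    have h := boxdotι_map (yoneda.obj a) Y (c := op d) k g.op
    dsimp only [yc]
    refine (congrArg (fun z => _ ≫ z ≫ y) this.symm).trans ?_
    rw [Category.assoc, reassoc_of% h]
    rfl
  have yc_eq {c c' : A} (m : b ⟶ c) (hm : nonIdentities W₁ m) (k : c ⟶ a) (m' : b ⟶ c')
      (hm' : nonIdentities W₁ m') (k' : c' ⟶ a) (h : m ≫ k = m' ≫ k') :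
      yc m hm k = yc m' hm' k' := by
    obtain ⟨e, k₁, k₂, hk₁, hk₂, rfl, -⟩ := r.exists_fac k
    obtain ⟨e', k₁', k₂', hk₁', hk₂', rfl, -⟩ := r.exists_fac k'
    have hm₁ := nonIdentities₁_comp r hm hk₁
    have hm₁' := nonIdentities₁_comp r hm' hk₁'
    rw [← yc_map m hm k₁ hk₁ hm₁, ← yc_map m' hm' k₁' hk₁' hm₁']
    obtain ⟨rfl, h₁, h₂⟩ := eq_of_comp_eq_comp r hm₁.1 hk₂ hm₁'.1 hk₂' (by simpa using h)
    simp only [eqToHom_refl, Category.comp_id, Category.id_comp] at h₁ h₂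
    subst h₂
    congr 1
    exact h₁.symm
  have yc_boundary {c d : A} (m : b ⟶ c) (hm : nonIdentities W₁ m) (n : d ⟶ a)
      (hn : nonIdentities W₂ n) (θ : c ⟶ d) :
      yc m hm (θ ≫ n) = boxdotι _ _ (boundaryElement W₂ n hn (m ≫ θ)) ≫
        (boundaryPushoutProductInr W₂ a f).app (op b) ≫ x := by
    have := latchingι W₁.op _ m.op ((nonIdentities_op_iff W₁ m.op).2 hm) ≫= h₁
    rw [reassoc_of% @latchingι_latchingMap, reassoc_of% @latchingι_latchingObjMap] at this
    have := (boxdotι _ _ (boundaryElement W₂ n hn θ) ≫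
      (boundaryPushoutProductInr W₂ a f).app (op c)) ≫= this
    rw [Category.assoc, Category.assoc, reassoc_of% @boxdotι_inr_boundaryPushoutProduct,
      boundaryMap_boundaryElement] at this
    refine this.symm.trans ?_
    rw [← NatTrans.naturality_assoc, reassoc_of% @boxdotι_map, boundary_map_boundaryElement]
  have yc_f {c : A} (m : b ⟶ c) (hm : nonIdentities W₁ m) (k : c ⟶ a) :
      f ≫ yc m hm k = boxdotι (yoneda.obj a) X (c := op b) (m ≫ k) ≫
        (boundaryPushoutProductInl W₂ a f).app (op b) ≫ x := by
    have := latchingι W₁.op _ m.op ((nonIdentities_op_iff W₁ m.op).2 hm) ≫= h₁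
    rw [reassoc_of% @latchingι_latchingMap, reassoc_of% @latchingι_latchingObjMap] at this
    have := (boxdotι (yoneda.obj a) X (c := op c) k ≫
      (boundaryPushoutProductInl W₂ a f).app (op c)) ≫= this
    rw [Category.assoc, Category.assoc, reassoc_of% @boxdotι_inl_boundaryPushoutProduct] at this
    refine this.symm.trans ?_
    rw [← NatTrans.naturality_assoc, reassoc_of% @boxdotι_map]
    rfl
  have yc_p {c : A} (m : b ⟶ c) (hm : nonIdentities W₁ m) (k : c ⟶ a) :
      yc m hm k ≫ p = boxdotι (yoneda.obj a) Y (c := op b) (m ≫ k) ≫ q := by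
    dsimp only [yc]
    rw [Category.assoc, Category.assoc, h₃, reassoc_of% @latchingι_latchingMap,
      reassoc_of% @boxdotι_map]
    rfl
  obtain ⟨l, hl₁, hl₂, hl₃⟩ := exists_lift_of_components (W₂ := W₂) a f (op b) (p := p) (x := x)
    (q := q) (fun k l => ∀ {c : A} (m : b ⟶ c) (hm : nonIdentities W₁ m) (k' : c ⟶ a),
      m ≫ k' = k → l = yc m hm k') (fun k => by
        by_cases hk : ∃ (c : A) (m : b ⟶ c) (_ : nonIdentities W₁ m) (k' : c ⟶ a), m ≫ k' = k
        · obtain ⟨c, m, hm, k, rfl⟩ := hk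
          refine ⟨yc m hm k, yc_f m hm k, yc_p m hm k, fun k' h => ?_,
            fun m' hm' k' h => yc_eq m hm k m' hm' k' h.symm⟩
          obtain ⟨d, n, hn, θ, hθ, rfl⟩ := exists_eq_boundaryElement_of_prop r k'
          rw [boundaryMap_boundaryElement] at h
          obtain ⟨e, k₁, k₂, hk₁, hk₂, rfl, -⟩ := r.exists_fac k
          have hm₁ := nonIdentities₁_comp r hm hk₁
          obtain ⟨rfl, h₁, h₂⟩ := eq_of_comp_eq_comp r hm₁.1 hk₂ hθ hn.1 (by simpa using h.symm)
          simp only [eqToHom_refl, Category.comp_id, Category.id_comp] at h₁ h₂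
          subst h₁ h₂
          exact yc_boundary m hm k₂ hn k₁
        · by_cases hk' : ∃ k', (boundaryMap W₂ a).app (op b) k' = k
          · obtain ⟨k, rfl⟩ := hk'
            refine ⟨boxdotι _ _ k ≫ (boundaryPushoutProductInr W₂ a f).app (op b) ≫ x, ?_, ?_,
              fun k' h => ?_, fun m hm k' h => (hk ⟨_, m, hm, k', h⟩).elim⟩
            · rw [reassoc_of% @boundaryPushoutProduct_condition]
            · rw [Category.assoc, Category.assoc, h₂,
                reassoc_of% @boxdotι_inr_boundaryPushoutProduct]
            · rw [boundaryMap_injective r h]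
          · have sq : CommSq (boxdotι _ _ k ≫
                (boundaryPushoutProductInl W₂ a f).app (op b) ≫ x) f p (boxdotι _ _ k ≫ q) := ⟨by
              rw [Category.assoc, Category.assoc, h₂,
                reassoc_of% @boxdotι_inl_boundaryPushoutProduct]⟩
            exact ⟨sq.lift, sq.fac_left, sq.fac_right, fun k' h => (hk' ⟨k', h⟩).elim,
              fun m hm k' h => (hk ⟨_, m, hm, k', h⟩).elim⟩)
  refine ⟨l, hl₁, ?_, hl₂⟩
  apply latchingObj_hom_ext
  intro c m hm
  rw [reassoc_of% @latchingι_latchingMap]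
  apply boxdot_hom_ext
  intro k
  rw [reassoc_of% @boxdotι_map]
  exact hl₃ _ m.unop ((nonIdentities_op_iff W₁ m).1 hm) k rfl

end LatchingOfPushoutProducts

end ReedyDiagrams

namespace ReedyDiagrams

open Opposite

section ReedyClasses

variable {B : Type w} [SmallCategory B] {M : Type u} [Category.{v} M]
  [HasLimitsOfSize.{w, w} M] [HasColimitsOfSize.{w, w} M] [ModelCategory M]

variable (B M) in
/-- The objectwise weak equivalences. -/
def objectwiseWeakEquivalences : MorphismProperty (B ⥤ M) :=
  fun _ _ f => ∀ b, weakEquivalences M (f.app b)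

/-- The morphisms all of whose relative latching morphisms are cofibrations. -/
def reedyCofibrations (W : MorphismProperty B) [W.IsMultiplicative] : MorphismProperty (B ⥤ M) :=
  fun _ _ f => ∀ b, cofibrations M (relativeLatchingMap W f b)

/-- The morphisms all of whose relative matching morphisms are fibrations. -/
def reedyFibrations (W : MorphismProperty B) [W.IsMultiplicative] : MorphismProperty (B ⥤ M) :=
  fun _ _ p => ∀ b, fibrations M (relativeMatchingMap W p b)

/-- The morphisms all of whose relative matching morphisms are trivial fibrations. -/
def reedyTrivialFibrations (W : MorphismProperty B) [W.IsMultiplicative] :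
    MorphismProperty (B ⥤ M) :=
  fun _ _ p => ∀ b, trivialFibrations M (relativeMatchingMap W p b)

instance : (objectwiseWeakEquivalences B M).HasTwoOutOfThreeProperty where
  comp_mem _ _ hf hg b := (weakEquivalences M).comp_mem _ _ (hf b) (hg b)
  of_postcomp _ _ hg hfg b := (weakEquivalences M).of_postcomp _ _ (hg b) (hfg b)
  of_precomp _ _ hf hfg b := (weakEquivalences M).of_precomp _ _ (hf b) (hfg b)

variable {W₁ W₂ : MorphismProperty B} [W₁.IsMultiplicative] [W₂.IsMultiplicative]
  {D : Type t} [LinearOrder D] [OrderBot D] [SuccOrder D] [WellFoundedLT D]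
  (r : ReedyStructure W₁ W₂ D)

include r

omit [HasColimitsOfSize.{w, w, v, u} M] in
lemma trivialFibrations_matchingObjMap {X Y : B ⥤ M} (p : X ⟶ Y) (b : B)
    (h : ∀ {c} (m : b ⟶ c), nonIdentities W₁ m →
      trivialFibrations M (relativeMatchingMap W₁ p c)) :
    trivialFibrations M (matchingObjMap W₁ p b) := by
  rw [← cofibrations_rlp]
  exact fun _ _ f hf => hasLiftingProperty_matchingObjMap r f p b fun m hm =>
    MorphismProperty.hasLiftingProperty_of_wfs f _ hf (h m hm)

omit [HasColimitsOfSize.{w, w, v, u} M] in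
lemma weakEquivalences_relativeMatchingMap_iff {X Y : B ⥤ M} (p : X ⟶ Y) (b : B)
    (h : ∀ {c} (m : b ⟶ c), nonIdentities W₁ m →
      trivialFibrations M (relativeMatchingMap W₁ p c)) :
    weakEquivalences M (relativeMatchingMap W₁ p b) ↔ weakEquivalences M (p.app b) := by
  have h₁ : trivialFibrations M
      (pullback.snd (matchingObjMap W₁ p b) (matchingMap W₁ Y b)) :=
    MorphismProperty.pullback_snd _ _ (trivialFibrations_matchingObjMap r p b h)
  have h₂ : relativeMatchingMap W₁ p b ≫ pullback.snd _ _ = p.app b := pullback.lift_snd _ _ _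
  rw [← h₂]
  exact ((weakEquivalences M).postcomp_iff (W' := weakEquivalences M) _ _ h₁.2).symm

omit [HasColimitsOfSize.{w, w, v, u} M] in
theorem reedyFibrations_inf_objectwiseWeakEquivalences :
    reedyFibrations W₁ ⊓ objectwiseWeakEquivalences B M = reedyTrivialFibrations W₁ := by
  ext X Y p
  refine ⟨fun ⟨h₁, h₂⟩ b => ?_, fun h => ⟨fun b => (h b).1, fun b => ?_⟩⟩
  · induction b using (InvImage.wf r.deg (wellFounded_lt (α := D))).induction with
    | _ b hb =>
      exact ⟨h₁ b, (weakEquivalences_relativeMatchingMap_iff r p b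
        fun m hm => hb _ (deg_lt_of_nonIdentities₁ r hm)).2 (h₂ b)⟩
  · exact (weakEquivalences_relativeMatchingMap_iff r p b fun _ _ => h _).1 (h b).2

lemma reedyCofibrations_le_llp_reedyTrivialFibrations :
    reedyCofibrations W₂ ≤ (reedyTrivialFibrations W₁ : MorphismProperty (B ⥤ M)).llp :=
  fun _ _ f hf _ _ p hp => hasLiftingProperty_of_relativeLatchingMap_relativeMatchingMap r f p
    fun b => MorphismProperty.hasLiftingProperty_of_wfs _ _ (hf b) (hp b)

end ReedyClasses

section Generators

variable {A : Type w} [SmallCategory A] {M : Type u} [Category.{w} M] [HasColimits M]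
  {W₁ W₂ : MorphismProperty A} [W₁.IsMultiplicative] [W₂.IsMultiplicative]

instance (K : MorphismProperty M) [MorphismProperty.IsSmall.{w} K] :
    MorphismProperty.IsSmall.{w} (boundaryPushoutProducts W₂ K) := by
  have : Small.{w} K.toSet := ‹MorphismProperty.IsSmall.{w} K›.small_toSet
  refine ⟨small_of_surjective (α := A × K.toSet) (f := fun x =>
    ⟨Arrow.mk (boundaryPushoutProduct W₂ x.1 x.2.1.hom), .mk x.1 _ x.2.2⟩) ?_⟩
  rintro ⟨g, hg⟩
  obtain ⟨X, Y, g⟩ := g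
  obtain ⟨a, f, hf⟩ := hg
  exact ⟨⟨a, Arrow.mk f, hf⟩, rfl⟩

variable [HasLimits M]

lemma rlp_boundaryPushoutProducts_iff (K : MorphismProperty M) {X Y : Aᵒᵖ ⥤ M} (p : X ⟶ Y) :
    (boundaryPushoutProducts W₂ K).rlp p ↔ ∀ b, K.rlp (relativeMatchingMap W₂.op p b) := by
  refine ⟨fun h b _ _ f hf =>
    (hasLiftingProperty_boundaryPushoutProduct_iff W₂ b.unop f p).1 (h _ (.mk _ f hf)), ?_⟩
  rintro h _ _ _ ⟨a, f, hf⟩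
  exact (hasLiftingProperty_boundaryPushoutProduct_iff W₂ a f p).2 (h (op a) f hf)

variable [ModelCategory M]

lemma rlp_boundaryPushoutProducts_eq_reedyFibrations {J : MorphismProperty M}
    (hJ : fibrations M = J.rlp) :
    (boundaryPushoutProducts W₂ J).rlp = reedyFibrations W₂.op := by
  ext X Y p
  rw [rlp_boundaryPushoutProducts_iff, ← hJ]
  rfl

lemma rlp_boundaryPushoutProducts_eq_reedyTrivialFibrations {I : MorphismProperty M}
    (hI : trivialFibrations M = I.rlp) :
    (boundaryPushoutProducts W₂ I).rlp = reedyTrivialFibrations W₂.op := by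
  ext X Y p
  rw [rlp_boundaryPushoutProducts_iff, ← hI]
  rfl

variable {D : Type t} [LinearOrder D] [OrderBot D] [SuccOrder D] [WellFoundedLT D]
  (r : ReedyStructure W₁ W₂ D)

include r

theorem rlp_llp_boundaryPushoutProducts_eq_reedyCofibrations {I : MorphismProperty M}
    (hI : trivialFibrations M = I.rlp) :
    (boundaryPushoutProducts W₂ I).rlp.llp = reedyCofibrations W₁.op := by
  refine le_antisymm (fun X Y f hf b => ?_) ?_
  · rw [← trivialFibrations_llp]
    intro P Q p hp
    refine hasLiftingProperty_relativeLatchingMap_of_rlp_llp W₁.op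
      (boundaryPushoutProducts W₂ I) b p ?_ f hf
    rintro _ _ _ ⟨a, i, hi⟩
    have : HasLiftingProperty i p := by
      rw [hI] at hp
      exact hp i hi
    exact hasLiftingProperty_relativeLatchingMap_boundaryPushoutProduct r a i b.unop p
  · rw [rlp_boundaryPushoutProducts_eq_reedyTrivialFibrations hI]
    exact reedyCofibrations_le_llp_reedyTrivialFibrations r.op

lemma rlp_llp_boundaryPushoutProducts_le_objectwiseWeakEquivalences {J : MorphismProperty M}
    (hJ : fibrations M = J.rlp) :
    (boundaryPushoutProducts W₂ J).rlp.llp ≤ objectwiseWeakEquivalences Aᵒᵖ M := by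
  intro X Y f hf b
  suffices trivialCofibrations M (f.app b) from this.2
  rw [← fibrations_llp]
  intro P Q p hp
  refine ((evaluationAdjunctionLeft M b).hasLiftingProperty_iff f p).2 (hf _ ?_)
  rintro _ _ _ ⟨a, j, hj⟩
  refine ((evaluationAdjunctionLeft M b).hasLiftingProperty_iff _ p).1 ?_
  have : HasLiftingProperty j p := by
    rw [hJ] at hp
    exact hp j hj
  exact hasLiftingProperty_boundaryPushoutProduct_app r a j b p

theorem rlp_llp_boundaryPushoutProducts_eq_inf {I J : MorphismProperty M}
    (hI : trivialFibrations M = I.rlp) (hJ : fibrations M = J.rlp)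
    [(boundaryPushoutProducts W₂ J).rlp.llp.HasFactorization (boundaryPushoutProducts W₂ J).rlp] :
    (boundaryPushoutProducts W₂ J).rlp.llp =
      reedyCofibrations W₁.op ⊓ objectwiseWeakEquivalences Aᵒᵖ M := by
  have hW := rlp_llp_boundaryPushoutProducts_le_objectwiseWeakEquivalences r hJ
  have hF := rlp_boundaryPushoutProducts_eq_reedyFibrations (W₂ := W₂) hJ
  have hTF := reedyFibrations_inf_objectwiseWeakEquivalences (M := M) r.op
  have hC := rlp_llp_boundaryPushoutProducts_eq_reedyCofibrations r hI
  rw [rlp_boundaryPushoutProducts_eq_reedyTrivialFibrations hI] at hC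
  refine le_antisymm (le_inf ?_ hW) fun X Y f hf => ?_
  · rw [hF, ← hC, ← hTF]
    exact MorphismProperty.antitone_llp inf_le_left
  · let d := MorphismProperty.factorizationData (boundaryPushoutProducts W₂ J).rlp.llp
      (boundaryPushoutProducts W₂ J).rlp f
    have hp : reedyTrivialFibrations W₂.op d.p := by
      rw [← hTF]
      refine ⟨by simpa only [← hF] using d.hp, ?_⟩
      exact (objectwiseWeakEquivalences Aᵒᵖ M).of_precomp d.i d.p (hW _ d.hi)
        (by simpa only [d.fac] using hf.2)
    have : HasLiftingProperty f d.p := by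
      rw [← hC] at hf
      exact hf.1 _ hp
    exact MorphismProperty.of_retract (RetractArrow.ofLeftLiftingProperty d.fac) d.hi

/-- The Reedy model structure on `M`-valued presheaves on a Reedy category, when `M` is
combinatorial. -/
@[reducible]
def reedyModelCategory {I J : MorphismProperty M}
    (hI : trivialFibrations M = I.rlp) (hJ : fibrations M = J.rlp)
    [(boundaryPushoutProducts W₂ I).rlp.llp.HasFactorization (boundaryPushoutProducts W₂ I).rlp]
    [(boundaryPushoutProducts W₂ J).rlp.llp.HasFactorization (boundaryPushoutProducts W₂ J).rlp] :
    ModelCategory (Aᵒᵖ ⥤ M) :=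
  letI : CategoryWithFibrations (Aᵒᵖ ⥤ M) := ⟨reedyFibrations W₂.op⟩
  letI : CategoryWithCofibrations (Aᵒᵖ ⥤ M) := ⟨reedyCofibrations W₁.op⟩
  letI : CategoryWithWeakEquivalences (Aᵒᵖ ⥤ M) := ⟨objectwiseWeakEquivalences Aᵒᵖ M⟩
  have : (weakEquivalences (Aᵒᵖ ⥤ M)).HasTwoOutOfThreeProperty :=
    inferInstanceAs (objectwiseWeakEquivalences Aᵒᵖ M).HasTwoOutOfThreeProperty
  have hC : (boundaryPushoutProducts W₂ I).rlp.llp = cofibrations (Aᵒᵖ ⥤ M) :=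
    rlp_llp_boundaryPushoutProducts_eq_reedyCofibrations r hI
  have hTF : (boundaryPushoutProducts W₂ I).rlp = trivialFibrations (Aᵒᵖ ⥤ M) :=
    (rlp_boundaryPushoutProducts_eq_reedyTrivialFibrations hI).trans
      (reedyFibrations_inf_objectwiseWeakEquivalences r.op).symm
  have hTC : (boundaryPushoutProducts W₂ J).rlp.llp = trivialCofibrations (Aᵒᵖ ⥤ M) :=
    rlp_llp_boundaryPushoutProducts_eq_inf r hI hJ
  have hF : (boundaryPushoutProducts W₂ J).rlp = fibrations (Aᵒᵖ ⥤ M) :=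
    rlp_boundaryPushoutProducts_eq_reedyFibrations hJ
  have : (cofibrations (Aᵒᵖ ⥤ M)).IsWeakFactorizationSystem (trivialFibrations (Aᵒᵖ ⥤ M)) := by
    rw [← hC, ← hTF]
    exact ⟨MorphismProperty.rlp_llp_rlp _, rfl, inferInstance⟩
  have : (trivialCofibrations (Aᵒᵖ ⥤ M)).IsWeakFactorizationSystem (fibrations (Aᵒᵖ ⥤ M)) := by
    rw [← hTC, ← hF]
    exact ⟨MorphismProperty.rlp_llp_rlp _, rfl, inferInstance⟩
  ModelCategory.mk' _

end Generators

end ReedyDiagrams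

open ReedyDiagrams in
theorem mainTheorem8
    {A : Type w} [SmallCategory A]
    (W₁ W₂ : MorphismProperty A) [W₁.IsMultiplicative] [W₂.IsMultiplicative]
    {D : Type t} [LinearOrder D] [OrderBot D] [SuccOrder D] [WellFoundedLT D]
    (r : ReedyStructure W₁ W₂ D)
    {M : Type u} [Category.{w} M] [HasLimits M] [HasColimits M] [ModelCategory M]
    (hM : ReedyDiagrams.IsCombinatorial.{w} M) :
    ∃ S : ModelCategory (Aᵒᵖ ⥤ M),
      ReedyDiagrams.IsReedyModelStructure W₂.op W₁.op S ∧
      ReedyDiagrams.IsCombinatorial.{w} (Aᵒᵖ ⥤ M) ∧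
      ∀ I J : MorphismProperty M, ReedyDiagrams.AreGenerating.{w} I J →
        ReedyDiagrams.AreGenerating.{w}
          (ReedyDiagrams.boundaryPushoutProducts W₂ I)
          (ReedyDiagrams.boundaryPushoutProducts W₂ J) := by
  have := hM.isLocallyPresentable
  have soa (K : MorphismProperty M) (_ : MorphismProperty.IsSmall.{w} K) :
      MorphismProperty.HasSmallObjectArgument.{w} (boundaryPushoutProducts W₂ K) :=
    hasSmallObjectArgument_of_isLocallyPresentable _
  obtain ⟨I, J, h⟩ := hM.exists_generating
  have := soa I h.isSmall_I
  have := soa J h.isSmall_J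
  let S := reedyModelCategory r h.trivialFibrations_eq h.fibrations_eq
  have generating (I J : MorphismProperty M) (h : AreGenerating.{w} I J) :
      AreGenerating.{w} (boundaryPushoutProducts W₂ I) (boundaryPushoutProducts W₂ J) :=
    have := h.isSmall_I
    have := h.isSmall_J
    { isSmall_I := inferInstance
      isSmall_J := inferInstance
      hasSmallObjectArgument_I := soa I h.isSmall_I
      hasSmallObjectArgument_J := soa J h.isSmall_J
      trivialFibrations_eq :=
        (reedyFibrations_inf_objectwiseWeakEquivalences r.op).trans
          (rlp_boundaryPushoutProducts_eq_reedyTrivialFibrations h.trivialFibrations_eq).symm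
      fibrations_eq := (rlp_boundaryPushoutProducts_eq_reedyFibrations h.fibrations_eq).symm }
  exact ⟨S, ⟨fun _ => Iff.rfl, fun _ => Iff.rfl, fun _ => Iff.rfl⟩,
    ⟨inferInstance, _, _, generating I J h⟩, generating⟩
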